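/- Let $N,M\ge 0$ be integers, $K=N+M$, and grade the indices by $[j]=0$ for $1\le j\le N$ and $[j]=1$ for $N<j\le K$. For $A\in \mathrm{End}(\mathbb C^{K})$ let $A_j$ denote $A$ acting in the $j$-th factor of the $\mathbb Z_2$-graded tensor product $\mathrm{End}(\mathbb C^{N|M})^{\otimes n}$ (so that homogeneous operators in different factors supercommute). Put $$P_{12}=\sum_{i,j=1}^{K}(-1)^{[j]}E_{ij}\otimes E_{ji},\qquad \pi=\sum_{j\ne N,K}E_{jj},\qquad \tilde\pi=\mathbb I-\pi,\qquad C=\pi-\tilde\pi,\qquad \Sigma_{12}=\pi_1\tilde\pi_2+\tilde\pi_1\pi_2,$$ except that $\pi=E_{11}$ when $N=M=1$, and $$R_{12}(\lambda)=\Sigma_{12}P_{12}+\Sigma_{12}\sin\lambda+(\mathbb I\otimes\mathbb I-\Sigma_{12})P_{12}\cos\lambda .$$ Let $U\in\mathbb C$ and let $h:\mathbb C\to\mathbb C$ be a function with $\sinh(2h(\lambda))=U\sin(2\lambda)$ for all $\lambda$. Write $\lambda_{ij}=\lambda_i-\lambda_j$, $\lambda'_{ij}=\lambda_i+\lambda_j$,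 $h_{ij}=h(\lambda_i)-h(\lambda_j)$, $h'_{ij}=h(\lambda_i)+h(\lambda_j)$, and define $$R_{<12><34>}(\lambda_1,\lambda_2)=R_{13}(\lambda_{12})R_{24}(\lambda_{12})+\frac{\sin\lambda_{12}}{\sin\lambda'_{12}}\tanh(h'_{12})\,R_{13}(\lambda'_{12})\,C_1\,R_{24}(\lambda'_{12})\,C_2 ,$$ and likewise with $1,2,3,4$ replaced by other factors. (1) Yang–Baxter equation. If $\sin\lambda'_{ij}\ne0$ and $\cosh h'_{ij}\ne 0$ for $(i,j)=(1,2),(1,3),(2,3)$, then in the six-fold graded tensor product $$R_{<12><34>}(\lambda_1,\lambda_2)R_{<12><56>}(\lambda_1,\lambda_3)R_{<34><56>}(\lambda_2,\lambda_3)=R_{<34><56>}(\lambda_2,\lambda_3)R_{<12><56>}(\lambda_1,\lambda_3)R_{<12><34>}(\lambda_1,\lambda_2).$$ (2) Unitarity. If $\sin\lambda'_{12}\ne0$ and $\cosh h'_{12}\ne0$, then in the four-fold graded tensor product $$R_{<12><34>}(\lambda_1,\lambda_2)\,R_{<34><12>}(\lambda_2,\lambda_1)=\Big(\cos^4\lambda_{12}-\Big(\frac{\sin\lambda_{12}}{\sin\lambda'_{12}}\tanh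 h'_{12}\Big)^2\cos^4\lambda'_{12}\Big)\,\mathbb I .$$ If moreover $\cosh h_{12}\neq 0$, this coefficient equals $$\cos^2\lambda_{12}\Big(\cos^2\lambda_{12}-\big(\tanh (h_{12})\cos\lambda'_{12}\big)^2\Big);$$ and if also $\cos\lambda'_{12}\ne0$, then $$\cos^4\lambda_{12}-\Big(\frac{\sin\lambda_{12}}{\sin\lambda'_{12}}\tanh h'_{12}\Big)^2=\cos^2\lambda_{12}\Big(\cos^2\lambda_{12}-\Big(\frac{\tanh h_{12}}{\cos\lambda'_{12}}\Big)^2\Big).$$ -/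

import Mathlib

noncomputable section

namespace SuperHubbard

/-- The `ℤ₂`-grading `[j]` of the basis indices of `ℂ^{N|M}`: the first `N` indices are bosonic
(grade `0`), the last `M` ones are fermionic (grade `1`). Indices are `0`-based, so the index
`j : Fin (N + M)` stands for `j + 1` in the range `1, …, N + M`. -/
def grade (N M : ℕ) (j : Fin (N + M)) : ℕ := if j.val < N then 0 else 1

/-- The algebra of linear operators on the `n`-fold tensor power of `ℂ^{N|M}`, as matrices in the
basis `e_{x 0} ⊗ ⋯ ⊗ e_{x (n-1)}`. -/
abbrev Op (N M n : ℕ) : Type :=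
  Matrix (Fin n → Fin (N + M)) (Fin n → Fin (N + M)) ℂ

/-- The operator `A_j`: the matrix `A` acting in the `j`-th factor of the `ℤ₂`-graded tensor
product. With the sign rule of graded tensor products, an elementary matrix `E_{ab}` placed at `j`
acts as
`e_{y 0} ⊗ ⋯ ⊗ e_{y (n-1)} ↦ (-1)^{([a]+[b])([y 0]+⋯+[y (j-1)])} e_{y 0} ⊗ ⋯ ⊗ E_{ab} e_{y j} ⊗ ⋯`,
so that homogeneous matrices placed at different factors supercommute. -/
def site (N M : ℕ) {n : ℕ} (j : Fin n) (A : Matrix (Fin (N + M)) (Fin (N + M)) ℂ) : Op N M n :=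
  Matrix.of fun x y =>
    if ∀ k, k ≠ j → x k = y k then
      (-1 : ℂ) ^ ((grade N M (x j) + grade N M (y j)) * ∑ k ∈ Finset.Iio j, grade N M (y k)) *
        A (x j) (y j)
    else 0

/-- The (super-)permutation `P_{ij} = ∑_{a,b} (-1)^{[b]} E_{ab} ⊗ E_{ba}`, with the two tensor
factors placed at `i` and `j`. -/
def perm (N M : ℕ) {n : ℕ} (i j : Fin n) : Op N M n :=
  ∑ a : Fin (N + M), ∑ b : Fin (N + M),
    ((-1 : ℂ) ^ grade N M b) •
      (site N M i (Matrix.single a b 1) * site N M j (Matrix.single b a 1))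

/-- The indices `j` on which the projector `π` is the identity: `j ≠ N, N + M` (`1`-based), except
for `gl(1|1)`, where by convention `π = E_{11}`. -/
def InPi (N M : ℕ) (j : Fin (N + M)) : Prop :=
  if N = 1 ∧ M = 1 then j.val + 1 = 1 else j.val + 1 ≠ N ∧ j.val + 1 ≠ N + M

open scoped Classical in
/-- The diagonal projector `π`. -/
def proj (N M : ℕ) : Matrix (Fin (N + M)) (Fin (N + M)) ℂ :=
  Matrix.diagonal fun j => if InPi N M j then 1 else 0

/-- The complementary projector `π̃ = 1 - π`. -/
def projCompl (N M : ℕ) : Matrix (Fin (N + M)) (Fin (N + M)) ℂ := 1 - proj N M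

/-- The diagonal matrix `C = π - π̃`. -/
def matC (N M : ℕ) : Matrix (Fin (N + M)) (Fin (N + M)) ℂ := proj N M - projCompl N M

/-- `Σ_{ij} = π_i π̃_j + π̃_i π_j`. -/
def sigma (N M : ℕ) {n : ℕ} (i j : Fin n) : Op N M n :=
  site N M i (proj N M) * site N M j (projCompl N M) +
    site N M i (projCompl N M) * site N M j (proj N M)

/-- The `gl(N|M)` XX R-matrix
`R_{ij}(t) = Σ_{ij} P_{ij} + Σ_{ij} sin t + (1 - Σ_{ij}) P_{ij} cos t`. -/
def xxR (N M : ℕ) {n : ℕ} (i j : Fin n) (t : ℂ) : Op N M n :=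
  sigma N M i j * perm N M i j + Complex.sin t • sigma N M i j +
    Complex.cos t • ((1 - sigma N M i j) * perm N M i j)

/-- The coupled R-matrix of the super-Hubbard model, acting in the factors `a, b, c, d`:
`R_{<ab><cd>}(s, t) = R_{ac}(s-t) R_{bd}(s-t)
  + (sin (s-t) / sin (s+t)) tanh (h s + h t) R_{ac}(s+t) C_a R_{bd}(s+t) C_b`. -/
def hubbardR (N M : ℕ) (h : ℂ → ℂ) {n : ℕ} (a b c d : Fin n) (s t : ℂ) : Op N M n :=
  xxR N M a c (s - t) * xxR N M b d (s - t) +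
    (Complex.sin (s - t) / Complex.sin (s + t) * Complex.tanh (h s + h t)) •
      (xxR N M a c (s + t) * site N M a (matC N M) * xxR N M b d (s + t) * site N M b (matC N M))

/-- The ratio and the hyperbolic tangent in `hubbardR` are well defined at `(s, t)`. -/
def Regular (h : ℂ → ℂ) (s t : ℂ) : Prop :=
  Complex.sin (s + t) ≠ 0 ∧ Complex.cosh (h s + h t) ≠ 0

end SuperHubbard

end

noncomputable section

namespace SuperHubbard

set_option linter.unusedSectionVars false
set_option linter.unusedSimpArgs false

open Equiv (swap)

/-! ### One-site operators and their supercommutation signs. -/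

section Sites

variable {N M n : ℕ}

/-! The fermionic signs enter only through the fact that the graded permutations `perm` and the
diagonal involutions `C` satisfy the ordinary relations of permutations acting on colored sites
(`isColoredPerm_site`). Since `π = (1 + C)/2`, the operator `Σ` is `(1 - C_i C_j)/2`, so the
R-matrix is a formula in `C` and `P`. Both claims are proved from `IsColoredPerm` alone, with
cosines and sines as parameters.

For Yang-Baxter, expand each side into eight terms according to which R-matrices carry the
decoration `C`. The layers `1,3,5` and `2,4,6` commute, so each term is a product `L L'` on the left
and `R R'` on the right, one factor per layer. Pulling the permutations out and splitting by color,
a word acts as a scalar where three sites have one color, and by a 3×3 matrix where one site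
differs. With an even number of decorations, `L = R` by addition formulas. With an odd number, `L =
±(X + Y)/2` and `R = ±(X - Y)/2`, where `Y` is the same for all four odd terms (`word_defect`) and
the weighted sum of the `X` vanishes (`exists_odd_eq`). As `L L' - R R' = (X Y' + Y X')/2`, the odd
terms cancel in total.

The vanishing of the sum of the `X` reduces to two trigonometric sums (`word_total`), hence to three
relations between the numbers `tanh h'_{ij} / sin λ'_{ij}` (`isCoupling`), and these follow from
`sinh 2h = U sin 2λ`.

Unitarity is a two-site computation: pure terms give `cos²` on each layer, and mixed terms cancel
because the coupling coefficient is odd under exchange. The other forms of the coefficient come from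
`hubbardCoeff_mul`. -/

lemma sum_eq_sum_update {ι κ R : Type*} [Fintype ι] [DecidableEq ι] [Fintype κ]
    [AddCommMonoid R] (j : ι) (x : ι → κ) (F : (ι → κ) → R)
    (hF : ∀ z, ¬(∀ k, k ≠ j → x k = z k) → F z = 0) :
    ∑ z, F z = ∑ a, F (Function.update x j a) := by
  classical
  symm
  refine Fintype.sum_of_injective _ (Function.update_injective x j) _ _ (fun z hz => hF z ?_)
    fun _ => rfl
  intro h
  refine hz ⟨z j, funext fun k => ?_⟩
  rcases eq_or_ne k j with rfl | hk
  · simp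
  · simp [hk, h k hk]

/-- The number of fermions to the left of the site `j`. -/
def leftGrade (N M : ℕ) (j : Fin n) (y : Fin n → Fin (N + M)) : ℕ :=
  ∑ k ∈ Finset.Iio j, grade N M (y k)

lemma leftGrade_congr {j : Fin n} {x y : Fin n → Fin (N + M)} (h : ∀ k < j, x k = y k) :
    leftGrade N M j x = leftGrade N M j y :=
  Finset.sum_congr rfl fun k hk => by rw [h k (Finset.mem_Iio.1 hk)]

lemma site_apply (j : Fin n) (A : Matrix (Fin (N + M)) (Fin (N + M)) ℂ)
    (x y : Fin n → Fin (N + M)) : site N M j A x y =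
      if ∀ k, k ≠ j → x k = y k then
        (-1 : ℂ) ^ ((grade N M (x j) + grade N M (y j)) * leftGrade N M j y) * A (x j) (y j)
      else 0 := rfl

lemma neg_one_pow_mul_self (m : ℕ) : (-1 : ℂ) ^ m * (-1) ^ m = 1 := by
  rw [← mul_pow]; simp

lemma site_mul_site (j : Fin n) (A B : Matrix (Fin (N + M)) (Fin (N + M)) ℂ) :
    site N M j A * site N M j B = site N M j (A * B) := by
  ext x y
  rw [Matrix.mul_apply, sum_eq_sum_update j x _ fun z hz => by rw [site_apply, if_neg hz, zero_mul]]
  have hc : ∀ a, (∀ k, k ≠ j → Function.update x j a k = y k) ↔ ∀ k, k ≠ j → x k = y k :=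
    fun a => forall₂_congr fun k hk => by rw [Function.update_of_ne hk]
  simp only [site_apply, hc, Function.update_self]
  by_cases h : ∀ k, k ≠ j → x k = y k
  · rw [if_pos h, Matrix.mul_apply, Finset.mul_sum]
    refine Finset.sum_congr rfl fun a _ => ?_
    rw [if_pos h, if_pos fun k hk => (Function.update_of_ne hk _ _).symm,
      leftGrade_congr (x := Function.update x j a) (y := y)
        fun k hk => by rw [Function.update_of_ne hk.ne, h k hk.ne]]
    simp only [add_mul, pow_add]
    linear_combination (-1 : ℂ) ^ (grade N M (x j) * leftGrade N M j y) *
      (-1 : ℂ) ^ (grade N M (y j) * leftGrade N M j y) * A (x j) a * B a (y j) *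
      neg_one_pow_mul_self (grade N M a * leftGrade N M j y)
  · simp [if_neg h]

/-- The intermediate index is forced: it equals `y` off `j` and `x` at `j`. The sign of the left
factor is counted on this updated index, which is where supercommutation comes from. -/
lemma site_mul_site_apply {i j : Fin n} (h : i ≠ j)
    (A B : Matrix (Fin (N + M)) (Fin (N + M)) ℂ) (x y : Fin n → Fin (N + M)) :
    (site N M i A * site N M j B) x y =
      if ∀ k, k ≠ i → k ≠ j → x k = y k then
        (-1 : ℂ) ^ ((grade N M (x i) + grade N M (y i)) *
            leftGrade N M i (Function.update y j (x j))) * A (x i) (y i) *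
          ((-1 : ℂ) ^ ((grade N M (x j) + grade N M (y j)) * leftGrade N M j y) * B (x j) (y j))
      else 0 := by
  rw [Matrix.mul_apply, Fintype.sum_eq_single (Function.update y j (x j))]
  · simp only [site_apply, Function.update_self, Function.update_of_ne h]
    rw [if_pos (c := ∀ k, k ≠ j → Function.update y j (x j) k = y k)
      fun k hk => Function.update_of_ne hk _ _]
    have : (∀ k, k ≠ i → x k = Function.update y j (x j) k) ↔
        ∀ k, k ≠ i → k ≠ j → x k = y k := by
      refine forall₂_congr fun k _ => ⟨fun hk hj => ?_, fun hk => ?_⟩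
      · rw [hk, Function.update_of_ne hj]
      · rcases eq_or_ne k j with rfl | hj
        · simp
        · rw [hk hj, Function.update_of_ne hj]
    simp only [this]
    split_ifs <;> simp
  · intro z hz
    rw [site_apply, site_apply]
    by_cases h1 : ∀ k, k ≠ i → x k = z k
    · rw [if_neg (c := ∀ k, k ≠ j → z k = y k), mul_zero]
      intro h2
      refine hz (funext fun k => ?_)
      rcases eq_or_ne k j with rfl | hk
      · rw [Function.update_self, h1 k h.symm]
      · rw [Function.update_of_ne hk, h2 k hk]
    · rw [if_neg h1, zero_mul]

/-- Written additively to avoid truncated subtraction. -/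
lemma leftGrade_update_of_lt {i j : Fin n} (h : i < j) (y : Fin n → Fin (N + M))
    (a : Fin (N + M)) :
    leftGrade N M j (Function.update y i a) + grade N M (y i) = leftGrade N M j y + grade N M a := by
  have hi : i ∈ Finset.Iio j := Finset.mem_Iio.2 h
  rw [leftGrade, leftGrade, ← Finset.add_sum_erase _ _ hi, ← Finset.add_sum_erase _ _ hi,
    Function.update_self, Finset.sum_congr rfl fun k hk => by
      rw [Function.update_of_ne (Finset.ne_of_mem_erase hk)]]
  ring

/-- The matrix `E_{ab}` in the factor `i`. -/
def unitAt (N M : ℕ) (i : Fin n) (a b : Fin (N + M)) : Op N M n :=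
  site N M i (Matrix.single a b 1)

lemma unitAt_mul_unitAt (i : Fin n) (a b c d : Fin (N + M)) :
    unitAt N M i a b * unitAt N M i c d = if b = c then unitAt N M i a d else 0 := by
  rw [unitAt, unitAt, site_mul_site]
  split_ifs with h
  · rw [h, Matrix.single_mul_single_same, one_mul, unitAt]
  · rw [Matrix.single_mul_single_of_ne _ _ _ _ h]
    ext x y
    simp [site_apply]

/-- The right-hand site has no effect on the fermion count to the left of `i`, while `E_{ab}` at `i`
changes the count to the left of `j` by `[a] - [b]`. -/
lemma unitAt_comm_of_lt {i j : Fin n} (h : i < j) (a b c d : Fin (N + M)) :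
    unitAt N M i a b * unitAt N M j c d =
      (-1 : ℂ) ^ ((grade N M a + grade N M b) * (grade N M c + grade N M d)) •
        (unitAt N M j c d * unitAt N M i a b) := by
  ext x y
  rw [Matrix.smul_apply, unitAt, unitAt, site_mul_site_apply h.ne, site_mul_site_apply h.ne',
    leftGrade_congr (j := i) (x := Function.update y j (x j)) (y := y)
      fun k hk => Function.update_of_ne (hk.trans h).ne _ _]
  by_cases hxy : ∀ k, k ≠ i → k ≠ j → x k = y k
  · rw [if_pos hxy, if_pos fun k hk hk' => hxy k hk' hk]
    by_cases h1 : a = x i ∧ b = y i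
    · by_cases h2 : c = x j ∧ d = y j
      · obtain ⟨rfl, rfl⟩ := h1
        obtain ⟨rfl, rfl⟩ := h2
        have hl := leftGrade_update_of_lt h y (x i)
        simp only [Matrix.single_apply_same, mul_one, smul_eq_mul]
        have he : (-1 : ℂ) ^ ((grade N M (x j) + grade N M (y j)) * leftGrade N M j y) =
            (-1) ^ ((grade N M (x i) + grade N M (y i)) * (grade N M (x j) + grade N M (y j))) *
              (-1) ^ ((grade N M (x j) + grade N M (y j)) *
                leftGrade N M j (Function.update y i (x i))) := by
          rw [← pow_add, mul_comm (grade N M (x i) + _), ← mul_add,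
            show grade N M (x i) + grade N M (y i) + leftGrade N M j (Function.update y i (x i)) =
              leftGrade N M j y + (grade N M (x i) + grade N M (x i)) by omega, mul_add, mul_add,
            pow_add, pow_add, neg_one_pow_mul_self, mul_one]
        rw [he]
        ring
      · simp [Matrix.single_apply, h2]
    · simp [Matrix.single_apply, h1]
  · rw [if_neg hxy, if_neg fun h' => hxy fun k hk hk' => h' k hk' hk, smul_zero]

lemma unitAt_comm {i j : Fin n} (h : i ≠ j) (a b c d : Fin (N + M)) :
    unitAt N M i a b * unitAt N M j c d =
      (-1 : ℂ) ^ ((grade N M a + grade N M b) * (grade N M c + grade N M d)) •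
        (unitAt N M j c d * unitAt N M i a b) := by
  rcases h.lt_or_gt with h | h
  · exact unitAt_comm_of_lt h a b c d
  · rw [unitAt_comm_of_lt h c d a b, smul_smul, mul_comm (grade N M a + grade N M b),
      neg_one_pow_mul_self, one_smul]

/-- Diagonal units are even, so the sign exponent is a multiple of two. -/
lemma site_diagonal (i : Fin n) (f : Fin (N + M) → ℂ) :
    site N M i (Matrix.diagonal f) = Matrix.diagonal fun x => f (x i) := by
  ext x y
  rw [site_apply]
  by_cases h : x = y
  · subst h
    simp only [implies_true, if_true, Matrix.diagonal_apply_eq, ← two_mul, mul_assoc, pow_mul]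
    simp
  · rw [Matrix.diagonal_apply_ne _ h]
    split_ifs with hk
    · rw [Matrix.diagonal_apply_ne, mul_zero]
      exact fun hi => h (funext fun k => by
        rcases eq_or_ne k i with rfl | hk'
        · exact hi
        · exact hk k hk')
    · rfl

lemma site_diagonal_eq_sum (i : Fin n) (f : Fin (N + M) → ℂ) :
    site N M i (Matrix.diagonal f) = ∑ a, f a • unitAt N M i a a := by
  have : ∀ a, unitAt N M i a a = Matrix.diagonal fun x => if x i = a then (1 : ℂ) else 0 := by
    intro a
    rw [unitAt, ← site_diagonal i fun b => if b = a then (1 : ℂ) else 0]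
    congr 1
    ext b c
    simp only [Matrix.single_apply, Matrix.diagonal_apply]
    grind
  ext x y
  simp only [this, site_diagonal, Matrix.sum_apply, Matrix.smul_apply, Matrix.diagonal_apply]
  by_cases h : x = y <;> simp [h]

lemma sum_unitAt (i : Fin n) : ∑ a, unitAt N M i a a = 1 := by
  have := site_diagonal_eq_sum (N := N) (M := M) i fun _ => 1
  rw [site_diagonal] at this
  simpa using this.symm

end Sites

/-! ### The graded permutation operators. -/

section Permutations

variable {N M n : ℕ}

lemma perm_eq (i j : Fin n) : perm N M i j =
    ∑ a, ∑ b, ((-1 : ℂ) ^ grade N M b) • (unitAt N M i a b * unitAt N M j b a) := rfl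

lemma grade_eq_zero_or_one (a : Fin (N + M)) : grade N M a = 0 ∨ grade N M a = 1 := by
  unfold grade
  split_ifs <;> simp

/-- Exchanging the two units costs `(-1)^([a]+[b])`, which turns the weight `(-1)^[b]` into
`(-1)^[a]`. -/
lemma perm_symm {i j : Fin n} (h : i ≠ j) : perm N M i j = perm N M j i := by
  rw [perm_eq, perm_eq, Finset.sum_comm]
  refine Finset.sum_congr rfl fun b _ => Finset.sum_congr rfl fun a _ => ?_
  rw [unitAt_comm h, smul_smul]
  congr 1
  rcases grade_eq_zero_or_one a with ha | ha <;> rcases grade_eq_zero_or_one b with hb | hb <;>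
    norm_num [ha, hb]

lemma perm_mul_unitAt_left {i j : Fin n} (h : i ≠ j) (c d : Fin (N + M)) :
    perm N M i j * unitAt N M i c d = unitAt N M j c d * perm N M i j := by
  have hl : perm N M i j * unitAt N M i c d =
      ∑ a, ((-1 : ℂ) ^ (grade N M c + (grade N M c + grade N M a) * (grade N M c + grade N M d))) •
        (unitAt N M i a d * unitAt N M j c a) := by
    rw [perm_eq, Finset.sum_mul]
    refine Finset.sum_congr rfl fun a _ => ?_
    rw [Finset.sum_mul, Fintype.sum_eq_single c]
    · rw [smul_mul_assoc, mul_assoc, unitAt_comm h.symm, mul_smul_comm, ← mul_assoc,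
        unitAt_mul_unitAt, if_pos rfl, smul_smul, pow_add]
    · intro b hb
      rw [smul_mul_assoc, mul_assoc, unitAt_comm h.symm, mul_smul_comm, ← mul_assoc,
        unitAt_mul_unitAt, if_neg hb, zero_mul, smul_zero, smul_zero]
  have hr : unitAt N M j c d * perm N M i j =
      ∑ a, ((-1 : ℂ) ^ (grade N M d + (grade N M c + grade N M d) * (grade N M a + grade N M d))) •
        (unitAt N M i a d * unitAt N M j c a) := by
    rw [perm_eq, Finset.mul_sum]
    refine Finset.sum_congr rfl fun a _ => ?_
    rw [Finset.mul_sum, Fintype.sum_eq_single d]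
    · rw [mul_smul_comm, ← mul_assoc, unitAt_comm h.symm, smul_mul_assoc, mul_assoc,
        unitAt_mul_unitAt, if_pos rfl, smul_smul, pow_add]
    · intro b hb
      rw [mul_smul_comm, ← mul_assoc, unitAt_comm h.symm, smul_mul_assoc, mul_assoc,
        unitAt_mul_unitAt, if_neg hb.symm, mul_zero, smul_zero, smul_zero]
  rw [hl, hr]
  refine Finset.sum_congr rfl fun a _ => ?_
  congr 1
  rcases grade_eq_zero_or_one a with ha | ha <;> rcases grade_eq_zero_or_one c with hc | hc <;>
    rcases grade_eq_zero_or_one d with hd | hd <;> norm_num [ha, hc, hd]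

lemma perm_mul_unitAt {k l : Fin n} (h : k ≠ l) (i : Fin n) (c d : Fin (N + M)) :
    perm N M k l * unitAt N M i c d = unitAt N M (swap k l i) c d * perm N M k l := by
  rcases eq_or_ne i k with rfl | hk
  · rw [Equiv.swap_apply_left, perm_mul_unitAt_left h]
  rcases eq_or_ne i l with rfl | hl
  · rw [Equiv.swap_apply_right, perm_symm h, perm_mul_unitAt_left h.symm]
  -- At a third site, `E_{ab}` and `E_{ba}` each produce the same sign, so the signs square away.
  rw [Equiv.swap_apply_of_ne_of_ne hk hl, perm_eq, Finset.sum_mul, Finset.mul_sum]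
  refine Finset.sum_congr rfl fun a _ => ?_
  rw [Finset.sum_mul, Finset.mul_sum]
  refine Finset.sum_congr rfl fun b _ => ?_
  rw [smul_mul_assoc, mul_assoc, unitAt_comm hl.symm, mul_smul_comm, ← mul_assoc,
    unitAt_comm hk.symm, smul_mul_assoc, smul_smul, mul_smul_comm, mul_assoc,
    add_comm (grade N M b), smul_smul, mul_assoc, neg_one_pow_mul_self, mul_one]

lemma perm_mul_perm {k l i j : Fin n} (h : k ≠ l) :
    perm N M k l * perm N M i j = perm N M (swap k l i) (swap k l j) * perm N M k l := by
  rw [perm_eq i j, perm_eq (swap k l i), Finset.sum_mul, Finset.mul_sum]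
  refine Finset.sum_congr rfl fun a _ => ?_
  rw [Finset.sum_mul, Finset.mul_sum]
  refine Finset.sum_congr rfl fun b _ => ?_
  rw [mul_smul_comm, smul_mul_assoc, ← mul_assoc, perm_mul_unitAt h, mul_assoc,
    perm_mul_unitAt h, mul_assoc]

lemma perm_mul_self {i j : Fin n} (h : i ≠ j) : perm N M i j * perm N M i j = 1 := by
  -- Each summand times the whole permutation collapses to `E_{aa} ⊗ E_{bb}`; these add up to the
  -- identity.
  have key : ∀ a b, (((-1 : ℂ) ^ grade N M b) • (unitAt N M i a b * unitAt N M j b a)) *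
      perm N M i j = unitAt N M i a a * unitAt N M j b b := by
    intro a b
    rw [perm_eq, Finset.mul_sum, Fintype.sum_eq_single b, Finset.mul_sum, Fintype.sum_eq_single a]
    · rw [smul_mul_smul_comm, mul_assoc, ← mul_assoc (unitAt N M j b a), unitAt_comm h.symm,
        smul_mul_assoc, mul_assoc (unitAt N M i b a), mul_smul_comm, ← mul_assoc,
        unitAt_mul_unitAt, unitAt_mul_unitAt, if_pos rfl, if_pos rfl, smul_smul]
      rcases grade_eq_zero_or_one a with ha | ha <;>
        rcases grade_eq_zero_or_one b with hb | hb <;> norm_num [ha, hb]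
    · intro d hd
      rw [smul_mul_smul_comm, mul_assoc, ← mul_assoc (unitAt N M j b a), unitAt_comm h.symm,
        smul_mul_assoc, mul_assoc (unitAt N M i b d), unitAt_mul_unitAt, if_neg hd.symm]
      simp
    · intro c hc
      rw [Finset.mul_sum]
      refine Finset.sum_eq_zero fun d _ => ?_
      rw [smul_mul_smul_comm, mul_assoc, ← mul_assoc (unitAt N M j b a), unitAt_comm h.symm,
        smul_mul_assoc, mul_assoc (unitAt N M i c d), mul_smul_comm, ← mul_assoc,
        unitAt_mul_unitAt, if_neg hc.symm]
      simp
  nth_rewrite 1 [perm_eq i j]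
  simp only [Finset.sum_mul, key, ← Finset.mul_sum, sum_unitAt, mul_one]

end Permutations

/-! ### Sign-free setting: colored sites and their permutations. -/

/-- Commuting involutions `C i` together with elements `P i j` which permute them, and one another,
as the transpositions of the index set do. -/
structure IsColoredPerm {ι A : Type*} [DecidableEq ι] [Ring A] (C : ι → A) (P : ι → ι → A) :
    Prop where
  C_sq : ∀ i, C i * C i = 1
  C_comm : ∀ i j, C i * C j = C j * C i
  P_symm : ∀ i j, i ≠ j → P i j = P j i
  P_sq : ∀ i j, i ≠ j → P i j * P i j = 1
  P_C : ∀ k l i, k ≠ l → P k l * C i = C (swap k l i) * P k l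
  P_P : ∀ k l i j, k ≠ l → i ≠ j → P k l * P i j = P (swap k l i) (swap k l j) * P k l

section ColoredPerm

variable {ι A : Type*} [DecidableEq ι] [Ring A] [Algebra ℂ A]

/-- The projector onto different colors at the sites `i` and `j`. -/
def diffProj (C : ι → A) (i j : ι) : A := (1 / 2 : ℂ) • (1 - C i * C j)

/-- The XX R-matrix with the trigonometric functions replaced by free parameters. -/
def xxOp (C : ι → A) (P : ι → ι → A) (c s : ℂ) (i j : ι) : A :=
  diffProj C i j * P i j + s • diffProj C i j + c • ((1 - diffProj C i j) * P i j)

/-- The braid form of `xxOp`. -/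
def braidOp (C : ι → A) (P : ι → ι → A) (c s : ℂ) (i j : ι) : A := P i j * xxOp C P c s i j

/-- The involution `C i`, or the identity. -/
def decor (C : ι → A) (a : Bool) (i : ι) : A := if a then C i else 1

variable {C : ι → A} {P : ι → ι → A}

lemma diffProj_mul_of_color {i j : ι} {v : A} {x y : ℂ} (hi : C i * v = x • v)
    (hj : C j * v = y • v) : diffProj C i j * v = ((1 - x * y) / 2) • v := by
  simp only [diffProj, smul_mul_assoc, sub_mul, one_mul, mul_assoc, hj, mul_smul_comm, hi]
  module

namespace IsColoredPerm

variable (H : IsColoredPerm C P)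
include H

lemma diffProj_symm (i j : ι) : diffProj C i j = diffProj C j i := by
  simp only [diffProj, H.C_comm i j]

lemma P_diffProj {k l : ι} (h : k ≠ l) (i j : ι) :
    P k l * diffProj C i j = diffProj C (swap k l i) (swap k l j) * P k l := by
  simp only [diffProj, mul_smul_comm, smul_mul_assoc, mul_sub, sub_mul, mul_one, one_mul]
  rw [← mul_assoc, H.P_C k l i h, mul_assoc, H.P_C k l j h, mul_assoc]

lemma P_xxOp {k l i j : ι} (h : k ≠ l) (h' : i ≠ j) (c s : ℂ) :
    P k l * xxOp C P c s i j = xxOp C P c s (swap k l i) (swap k l j) * P k l := by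
  simp only [xxOp, mul_add, add_mul, mul_smul_comm, smul_mul_assoc, sub_mul, mul_sub, one_mul]
  have e : P k l * (diffProj C i j * P i j) =
      diffProj C (swap k l i) (swap k l j) * P (swap k l i) (swap k l j) * P k l := by
    rw [← mul_assoc, H.P_diffProj h, mul_assoc, H.P_P k l i j h h', mul_assoc]
  rw [e, H.P_diffProj h, H.P_P k l i j h h']

lemma xxOp_symm {i j : ι} (h : i ≠ j) (c s : ℂ) : xxOp C P c s i j = xxOp C P c s j i := by
  simp only [xxOp, H.diffProj_symm i j, H.P_symm i j h]

lemma P_braidOp {k l i j : ι} (h : k ≠ l) (h' : i ≠ j) (c s : ℂ) :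
    P k l * braidOp C P c s i j = braidOp C P c s (swap k l i) (swap k l j) * P k l := by
  rw [braidOp, ← mul_assoc, H.P_P k l i j h h', mul_assoc, H.P_xxOp h h', braidOp, mul_assoc]

lemma P_decor {k l : ι} (h : k ≠ l) (a : Bool) (i : ι) :
    P k l * decor C a i = decor C a (swap k l i) * P k l := by
  cases a <;> simp [decor, H.P_C k l i h]

lemma xxOp_eq {i j : ι} (h : i ≠ j) (c s : ℂ) :
    xxOp C P c s i j = P i j * braidOp C P c s i j := by
  rw [braidOp, ← mul_assoc, H.P_sq i j h, one_mul]

/-- In this form the action by color is visible: `c` on equal colors, `1 + s P` on different ones.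
-/
lemma braidOp_eq {i j : ι} (h : i ≠ j) (c s : ℂ) :
    braidOp C P c s i j =
      diffProj C i j + s • (P i j * diffProj C i j) + c • (1 - diffProj C i j) := by
  have e : P i j * diffProj C i j = diffProj C i j * P i j := by
    rw [H.P_diffProj h, Equiv.swap_apply_left, Equiv.swap_apply_right, H.diffProj_symm]
  have e2 : P i j * (diffProj C i j * P i j) = diffProj C i j := by
    rw [← mul_assoc, e, mul_assoc, H.P_sq i j h, mul_one]
  simp only [braidOp, xxOp, mul_add, mul_smul_comm, sub_mul, mul_sub, one_mul, e2,
    H.P_sq i j h]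

lemma C_mul_P_mul {i j : ι} (h : i ≠ j) {k : ι} {v : A} {x : ℂ}
    (hv : C (swap i j k) * v = x • v) : C k * (P i j * v) = x • (P i j * v) := by
  have := H.P_C i j (swap i j k) h
  rw [Equiv.swap_apply_self] at this
  rw [← mul_assoc, ← this, mul_assoc, hv, mul_smul_comm]

lemma braidOp_mul_of_same {i j : ι} (h : i ≠ j) {v : A} {x : ℂ} (hx : x * x = 1)
    (hi : C i * v = x • v) (hj : C j * v = x • v) (c s : ℂ) :
    braidOp C P c s i j * v = c • v := by
  have e := diffProj_mul_of_color hi hj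
  rw [hx, sub_self, zero_div, zero_smul] at e
  simp [H.braidOp_eq h, add_mul, sub_mul, mul_assoc, e]

lemma braidOp_mul_of_diff {i j : ι} (h : i ≠ j) {v : A} {x y : ℂ} (hx : x * y = -1)
    (hi : C i * v = x • v) (hj : C j * v = y • v) (c s : ℂ) :
    braidOp C P c s i j * v = v + s • (P i j * v) := by
  have e := diffProj_mul_of_color hi hj
  rw [hx, show (1 - -1 : ℂ) / 2 = 1 by norm_num, one_smul] at e
  simp [H.braidOp_eq h, add_mul, sub_mul, mul_assoc, e]

/-- An element annihilates `v` if it annihilates both eigencomponents of `v` for `C i`. -/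
lemma mul_eq_zero_of_color (i : ι) {Z v : A}
    (h : ∀ x : ℂ, x * x = 1 → Z * (v + x • (C i * v)) = 0) : Z * v = 0 := by
  have h1 := h 1 (by norm_num)
  have h2 := h (-1) (by norm_num)
  have : v = (1 / 2 : ℂ) • ((v + (1 : ℂ) • (C i * v)) + (v + (-1 : ℂ) • (C i * v))) := by module
  rw [this, mul_smul_comm, mul_add, h1, h2, add_zero, smul_zero]

lemma C_mul_add_self (i : ι) (v : A) {x : ℂ} (hx : x * x = 1) :
    C i * (v + x • (C i * v)) = x • (v + x • (C i * v)) := by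
  rw [mul_add, mul_smul_comm, ← mul_assoc, H.C_sq, one_mul, smul_add, smul_smul, hx, one_smul,
    add_comm]

lemma C_mul_add_other (i j : ι) {v : A} {x y : ℂ} (hv : C j * v = y • v) :
    C j * (v + x • (C i * v)) = y • (v + x • (C i * v)) := by
  rw [mul_add, mul_smul_comm, ← mul_assoc, H.C_comm j i, mul_assoc, hv, mul_smul_comm, smul_add,
    smul_comm]

end IsColoredPerm

/-- The orbit under permutations of a vector whose color at site `i` differs from its color `x`
at the sites `j` and `k`. -/
structure IsOrbit (C : ι → A) (P : ι → ι → A) (i j k : ι) (x : ℂ) (e₁ e₂ e₃ : A) : Prop where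
  sq : x * x = 1
  i₁ : C i * e₁ = (-x) • e₁
  j₁ : C j * e₁ = x • e₁
  k₁ : C k * e₁ = x • e₁
  i₂ : C i * e₂ = x • e₂
  j₂ : C j * e₂ = (-x) • e₂
  k₂ : C k * e₂ = x • e₂
  i₃ : C i * e₃ = x • e₃
  j₃ : C j * e₃ = x • e₃
  k₃ : C k * e₃ = (-x) • e₃
  P₁ : P i j * e₁ = e₂
  P₂ : P i j * e₂ = e₁
  Q₂ : P j k * e₂ = e₃
  Q₃ : P j k * e₃ = e₂

namespace IsColoredPerm

variable (H : IsColoredPerm C P)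
include H

lemma isOrbit {i j k : ι} (hij : i ≠ j) (hik : i ≠ k) (hjk : j ≠ k) {x : ℂ} (hx : x * x = 1)
    {v : A} (hi : C i * v = (-x) • v) (hj : C j * v = x • v) (hk : C k * v = x • v) :
    IsOrbit C P i j k x v (P i j * v) (P j k * (P i j * v)) := by
  have i₂ : C i * (P i j * v) = x • (P i j * v) := H.C_mul_P_mul hij (by simpa using hj)
  have j₂ : C j * (P i j * v) = (-x) • (P i j * v) := H.C_mul_P_mul hij (by simpa using hi)
  have k₂ : C k * (P i j * v) = x • (P i j * v) :=
    H.C_mul_P_mul hij (by rwa [Equiv.swap_apply_of_ne_of_ne hik.symm hjk.symm])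
  exact
  { sq := hx, i₁ := hi, j₁ := hj, k₁ := hk, i₂ := i₂, j₂ := j₂, k₂ := k₂
    i₃ := H.C_mul_P_mul hjk (by rwa [Equiv.swap_apply_of_ne_of_ne hij hik])
    j₃ := H.C_mul_P_mul hjk (by simpa using k₂)
    k₃ := H.C_mul_P_mul hjk (by simpa using j₂)
    P₁ := rfl
    P₂ := by rw [← mul_assoc, H.P_sq i j hij, one_mul]
    Q₂ := rfl
    Q₃ := by rw [← mul_assoc, H.P_sq j k hjk, one_mul] }

/-- An element which annihilates all vectors of a definite color at three sites vanishes. -/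
lemma eq_zero_of_sectors {i j k : ι} (hij : i ≠ j) (hik : i ≠ k) (hjk : j ≠ k) {Z : A}
    (hS : ∀ (x : ℂ) (v : A), x * x = 1 → C i * v = x • v → C j * v = x • v → C k * v = x • v →
      Z * v = 0)
    (hO : ∀ (x : ℂ) (e₁ e₂ e₃ : A), IsOrbit C P i j k x e₁ e₂ e₃ →
      Z * e₁ = 0 ∧ Z * e₂ = 0 ∧ Z * e₃ = 0) : Z = 0 := by
  -- There are only two colors, so among three sites either all agree or exactly one is
  -- distinguished; in the latter case `v` is moved back along its orbit to the vector distinguished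
  -- at `i`.
  have key : ∀ (x y z : ℂ) (v : A), x * x = 1 → y * y = 1 → z * z = 1 → C i * v = x • v →
      C j * v = y • v → C k * v = z • v → Z * v = 0 := by
    intro x y z v hx hy hz hi hj hk
    rcases (mul_self_eq_mul_self_iff.1 (hy.trans hx.symm)) with rfl | rfl <;>
      rcases (mul_self_eq_mul_self_iff.1 (hz.trans hx.symm)) with rfl | rfl
    · exact hS _ v hx hi hj hk
    · -- the site `k` is distinguished
      have o := H.isOrbit hij hik hjk (v := P i j * (P j k * v)) hx
        (H.C_mul_P_mul hij (by
          rw [Equiv.swap_apply_left]; exact H.C_mul_P_mul hjk (by simpa using hk)))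
        (H.C_mul_P_mul hij (by
          rw [Equiv.swap_apply_right]
          exact H.C_mul_P_mul hjk (by rwa [Equiv.swap_apply_of_ne_of_ne hij hik])))
        (H.C_mul_P_mul hij (by
          rw [Equiv.swap_apply_of_ne_of_ne hik.symm hjk.symm]
          exact H.C_mul_P_mul hjk (by simpa using hj)))
      have := (hO _ _ _ _ o).2.2
      rwa [← mul_assoc (P i j) (P i j), H.P_sq i j hij, one_mul, ← mul_assoc (P j k) (P j k),
        H.P_sq j k hjk, one_mul] at this
    · -- the site `j` is distinguished
      have o := H.isOrbit hij hik hjk (v := P i j * v) hx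
        (H.C_mul_P_mul hij (by simpa using hj)) (H.C_mul_P_mul hij (by simpa using hi))
        (H.C_mul_P_mul hij (by rwa [Equiv.swap_apply_of_ne_of_ne hik.symm hjk.symm]))
      have := (hO _ _ _ _ o).2.1
      rwa [← mul_assoc (P i j) (P i j), H.P_sq i j hij, one_mul] at this
    · exact (hO _ _ _ _ (H.isOrbit hij hik hjk (v := v) (x := -x) (by simpa using hx)
        (by simpa using hi) hj hk)).1
  -- Elements of `A` serve as vectors of the left regular representation, so it suffices to kill the
  -- color components of `1`.
  rw [← mul_one Z]
  refine H.mul_eq_zero_of_color i fun x hx => ?_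
  refine H.mul_eq_zero_of_color j fun y hy => ?_
  refine H.mul_eq_zero_of_color k fun z hz => ?_
  exact key x y z _ hx hy hz
    (H.C_mul_add_other _ _ (H.C_mul_add_other _ _ (H.C_mul_add_self _ _ hx)))
    (H.C_mul_add_other _ _ (H.C_mul_add_self _ _ hy)) (H.C_mul_add_self _ _ hz)

end IsColoredPerm

end ColoredPerm

/-! ### Products of three decorated R-matrices and their matrices on color sectors. -/

section Words

/-- The spectral data of a product of three decorated R-matrices: cosine and sine of the three
spectral parameters, and the decorations. -/
structure WordData where
  u : ℂ × ℂ
  v : ℂ × ℂ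
  w : ℂ × ℂ
  a : Bool
  b : Bool
  c : Bool

/-- The sign `(-1)^a`. -/
def sg (a : Bool) : ℂ := if a then -1 else 1

lemma sg_mul_self (a : Bool) : sg a * sg a = 1 := by cases a <;> simp [sg]

/-- The power `x ^ a`. -/
def bpow (x : ℂ) (a : Bool) : ℂ := if a then x else 1

lemma bpow_neg (x : ℂ) (a : Bool) : bpow (-x) a = sg a * bpow x a := by
  cases a <;> simp [sg, bpow]

namespace WordData

/-- The number of decorations is odd. -/
def Odd (W : WordData) : Prop := (W.a ^^ W.b ^^ W.c) = true

/-- The number of decorations is even. -/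
def Even (W : WordData) : Prop := (W.a ^^ W.b ^^ W.c) = false

variable {W : WordData}

lemma Odd.sg_eq (h : W.Odd) : sg W.c = -(sg W.a * sg W.b) := by
  obtain ⟨u, v, w, a, b, c⟩ := W
  revert h
  cases a <;> cases b <;> cases c <;> simp [Odd, sg]

lemma Even.sg_eq (h : W.Even) : sg W.c = sg W.a * sg W.b := by
  obtain ⟨u, v, w, a, b, c⟩ := W
  revert h
  cases a <;> cases b <;> cases c <;> simp [Even, sg]

lemma Odd.bpow_eq (h : W.Odd) {x : ℂ} (hx : x * x = 1) :
    bpow x W.a * bpow x W.b * bpow x W.c = x := by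
  obtain ⟨u, v, w, a, b, c⟩ := W
  revert h
  cases a <;> cases b <;> cases c <;> simp [Odd, bpow, hx]

lemma Even.bpow_eq (h : W.Even) {x : ℂ} (hx : x * x = 1) :
    bpow x W.a * bpow x W.b * bpow x W.c = 1 := by
  obtain ⟨u, v, w, a, b, c⟩ := W
  revert h
  cases a <;> cases b <;> cases c <;> simp [Even, bpow, hx]

end WordData

variable {ι A : Type*} [DecidableEq ι] [Ring A] [Algebra ℂ A]

/-- The decorated R-matrix. -/
def decOp (C : ι → A) (P : ι → ι → A) (u : ℂ × ℂ) (a : Bool) (i j : ι) : A :=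
  xxOp C P u.1 u.2 i j * decor C a i

/-- One side of the Yang-Baxter equation for decorated R-matrices. -/
def leftWord (C : ι → A) (P : ι → ι → A) (i j k : ι) (W : WordData) : A :=
  decOp C P W.u W.a i j * decOp C P W.v W.b i k * decOp C P W.w W.c j k

/-- The other side of the Yang-Baxter equation for decorated R-matrices. -/
def rightWord (C : ι → A) (P : ι → ι → A) (i j k : ι) (W : WordData) : A :=
  decOp C P W.w W.c j k * decOp C P W.v W.b i k * decOp C P W.u W.a i j

/-- The braid form of `leftWord`. -/
def leftBraid (C : ι → A) (P : ι → ι → A) (i j k : ι) (W : WordData) : A :=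
  braidOp C P W.u.1 W.u.2 j k * (decor C W.a j * (braidOp C P W.v.1 W.v.2 i j *
    (decor C W.b i * (braidOp C P W.w.1 W.w.2 j k * decor C W.c j))))

/-- The braid form of `rightWord`. -/
def rightBraid (C : ι → A) (P : ι → ι → A) (i j k : ι) (W : WordData) : A :=
  braidOp C P W.w.1 W.w.2 i j * (decor C W.c i * (braidOp C P W.v.1 W.v.2 j k *
    (decor C W.b j * (braidOp C P W.u.1 W.u.2 i j * decor C W.a i))))

variable {C : ι → A} {P : ι → ι → A}

lemma decor_mul {i : ι} {e : A} {x : ℂ} (h : C i * e = x • e) (a : Bool) :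
    decor C a i * e = bpow x a • e := by
  cases a <;> simp [decor, bpow, h]

namespace IsColoredPerm

variable (H : IsColoredPerm C P)
include H

/-- The trailing `X` lets the rule rewrite inside right-nested products, pulling permutations to the
front. -/
lemma braid_decor_mul_P {i j k l : ι} (hij : i ≠ j) (hkl : k ≠ l) (c s : ℂ) (a : Bool) (X : A) :
    braidOp C P c s i j * (decor C a i * (P k l * X)) =
      P k l * (braidOp C P c s (swap k l i) (swap k l j) * (decor C a (swap k l i) * X)) := by
  have h1 := H.P_decor hkl a (swap k l i)
  rw [Equiv.swap_apply_self] at h1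
  have h2 := H.P_braidOp hkl ((swap k l).injective.ne hij) c s
  rw [Equiv.swap_apply_self, Equiv.swap_apply_self] at h2
  rw [← mul_assoc (decor C a i), ← h1, mul_assoc, ← mul_assoc, ← h2, mul_assoc]

/-- The extracted permutations multiply to `P_{ij} P_{ik} P_{jk} = P_{ik}`, and the braid operators
left behind involve only the pairs `(i,j)` and `(j,k)`. The same prefactor arises for `rightWord`,
so the braid words can be compared directly. -/
lemma leftWord_eq {i j k : ι} (hij : i ≠ j) (hik : i ≠ k) (hjk : j ≠ k) (W : WordData) :
    leftWord C P i j k W = P i k * leftBraid C P i j k W := by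
  have hP : P i j * (P i k * (P j k * leftBraid C P i j k W)) =
      P i k * leftBraid C P i j k W := by
    rw [← mul_assoc (P i k), H.P_P i k j k hik hjk, Equiv.swap_apply_right,
      Equiv.swap_apply_of_ne_of_ne hij.symm hjk, H.P_symm j i hij.symm, mul_assoc, ← mul_assoc,
      H.P_sq i j hij, one_mul]
  rw [← hP]
  simp only [leftWord, decOp, H.xxOp_eq hij, H.xxOp_eq hik, H.xxOp_eq hjk, mul_assoc]
  rw [H.braid_decor_mul_P hik hjk, Equiv.swap_apply_right,
    Equiv.swap_apply_of_ne_of_ne hij hik, H.braid_decor_mul_P hij hik, Equiv.swap_apply_left,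
    Equiv.swap_apply_of_ne_of_ne hij.symm hjk, H.braid_decor_mul_P hjk.symm hjk,
    Equiv.swap_apply_left, Equiv.swap_apply_right, leftBraid]

lemma rightWord_eq {i j k : ι} (hij : i ≠ j) (hik : i ≠ k) (hjk : j ≠ k) (W : WordData) :
    rightWord C P i j k W = P i k * rightBraid C P i j k W := by
  have hP : P j k * (P i k * (P i j * rightBraid C P i j k W)) =
      P i k * rightBraid C P i j k W := by
    rw [← mul_assoc (P j k), H.P_P j k i k hjk hik, Equiv.swap_apply_right,
      Equiv.swap_apply_of_ne_of_ne hij hik, mul_assoc, ← mul_assoc (P i j),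
      H.P_P i j j k hij hjk, Equiv.swap_apply_right,
      Equiv.swap_apply_of_ne_of_ne hik.symm hjk.symm, mul_assoc, ← mul_assoc (P i j),
      H.P_sq i j hij, one_mul]
  rw [← hP]
  simp only [rightWord, decOp, H.xxOp_eq hij, H.xxOp_eq hik, H.xxOp_eq hjk, mul_assoc]
  rw [H.braid_decor_mul_P hik hij, Equiv.swap_apply_left,
    Equiv.swap_apply_of_ne_of_ne hik.symm hjk.symm, H.braid_decor_mul_P hjk hik,
    Equiv.swap_apply_right, Equiv.swap_apply_of_ne_of_ne hij.symm hjk,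
    H.braid_decor_mul_P hij.symm hij,
    Equiv.swap_apply_left, Equiv.swap_apply_right, rightBraid]

end IsColoredPerm

namespace IsOrbit

variable {i j k : ι} {x : ℂ} {e₁ e₂ e₃ : A} (O : IsOrbit C P i j k x e₁ e₂ e₃)
  (H : IsColoredPerm C P)

include O

lemma decor_i₁ (a : Bool) : decor C a i * e₁ = (sg a * bpow x a) • e₁ := by
  rw [decor_mul O.i₁, bpow_neg]

lemma decor_j₂ (a : Bool) : decor C a j * e₂ = (sg a * bpow x a) • e₂ := by
  rw [decor_mul O.j₂, bpow_neg]

include H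

lemma braid_ij₁ (h : i ≠ j) (c s : ℂ) : braidOp C P c s i j * e₁ = e₁ + s • e₂ := by
  rw [H.braidOp_mul_of_diff h (by rw [neg_mul, O.sq]) O.i₁ O.j₁, O.P₁]

lemma braid_ij₂ (h : i ≠ j) (c s : ℂ) : braidOp C P c s i j * e₂ = e₂ + s • e₁ := by
  rw [H.braidOp_mul_of_diff h (by rw [mul_neg, O.sq]) O.i₂ O.j₂, O.P₂]

lemma braid_ij₃ (h : i ≠ j) (c s : ℂ) : braidOp C P c s i j * e₃ = c • e₃ :=
  H.braidOp_mul_of_same h O.sq O.i₃ O.j₃ c s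

lemma braid_jk₁ (h : j ≠ k) (c s : ℂ) : braidOp C P c s j k * e₁ = c • e₁ :=
  H.braidOp_mul_of_same h O.sq O.j₁ O.k₁ c s

lemma braid_jk₂ (h : j ≠ k) (c s : ℂ) : braidOp C P c s j k * e₂ = e₂ + s • e₃ := by
  rw [H.braidOp_mul_of_diff h (by rw [neg_mul, O.sq]) O.j₂ O.k₂, O.Q₂]

lemma braid_jk₃ (h : j ≠ k) (c s : ℂ) : braidOp C P c s j k * e₃ = e₃ + s • e₂ := by
  rw [H.braidOp_mul_of_diff h (by rw [mul_neg, O.sq]) O.j₃ O.k₃, O.Q₃]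

variable (hij : i ≠ j) (hjk : j ≠ k) (W : WordData)
include hij hjk

/-- Each braid factor either scales an orbit vector or mixes it with its neighbor, so the span of
the three is preserved. A decoration gives its color factor `bpow x`, with an extra sign `sg` when
it hits the distinguished site. -/
lemma leftBraid_mul :
    leftBraid C P i j k W * e₁ =
      (bpow x W.a * bpow x W.b * bpow x W.c) •
        ((sg W.b * W.u.1 * W.w.1) • e₁ +
          (sg W.a * sg W.b * W.v.2 * W.w.1) • e₂ +
          (sg W.a * sg W.b * W.u.2 * W.v.2 * W.w.1) • e₃) ∧
    leftBraid C P i j k W * e₂ =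
      (bpow x W.a * bpow x W.b * bpow x W.c) •
        ((sg W.c * W.u.1 * W.v.2) • e₁ +
          (sg W.a * sg W.c + sg W.c * W.u.2 * W.v.1 * W.w.2) • e₂ +
          (sg W.a * sg W.c * W.u.2 + sg W.c * W.v.1 * W.w.2) • e₃) ∧
    leftBraid C P i j k W * e₃ =
      (bpow x W.a * bpow x W.b * bpow x W.c) •
        ((W.u.1 * W.v.2 * W.w.2) • e₁ +
          (sg W.a * W.w.2 + W.u.2 * W.v.1) • e₂ +
          (sg W.a * W.u.2 * W.w.2 + W.v.1) • e₃) := by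
  refine ⟨?_, ?_, ?_⟩ <;>
  · simp only [leftBraid, mul_assoc, mul_add, mul_smul_comm, smul_add, O.decor_i₁, O.decor_j₂,
      decor_mul O.j₁, decor_mul O.i₂, decor_mul O.i₃, decor_mul O.j₃, O.braid_ij₁ H hij,
      O.braid_ij₂ H hij, O.braid_ij₃ H hij, O.braid_jk₁ H hjk, O.braid_jk₂ H hjk,
      O.braid_jk₃ H hjk]
    module

lemma rightBraid_mul :
    rightBraid C P i j k W * e₁ =
      (bpow x W.a * bpow x W.b * bpow x W.c) •
        ((sg W.a * sg W.c * W.v.1 + sg W.a * sg W.b * W.u.2 * W.w.2) • e₁ +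
          (sg W.a * sg W.c * W.v.1 * W.w.2 + sg W.a * sg W.b * W.u.2) • e₂ +
          (sg W.a * sg W.b * W.u.2 * W.v.2 * W.w.1) • e₃) ∧
    rightBraid C P i j k W * e₂ =
      (bpow x W.a * bpow x W.b * bpow x W.c) •
        ((sg W.b * W.w.2 + sg W.c * W.u.2 * W.v.1) • e₁ +
          (sg W.b + sg W.c * W.u.2 * W.v.1 * W.w.2) • e₂ +
          (sg W.b * W.v.2 * W.w.1) • e₃) ∧
    rightBraid C P i j k W * e₃ =
      (bpow x W.a * bpow x W.b * bpow x W.c) •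
        ((W.u.1 * W.v.2 * W.w.2) • e₁ +
          (W.u.1 * W.v.2) • e₂ +
          (W.u.1 * W.w.1) • e₃) := by
  refine ⟨?_, ?_, ?_⟩ <;>
  · simp only [rightBraid, mul_assoc, mul_add, mul_smul_comm, smul_add, O.decor_i₁, O.decor_j₂,
      decor_mul O.j₁, decor_mul O.i₂, decor_mul O.i₃, decor_mul O.j₃, O.braid_ij₁ H hij,
      O.braid_ij₂ H hij, O.braid_ij₃ H hij, O.braid_jk₁ H hjk, O.braid_jk₂ H hjk,
      O.braid_jk₃ H hjk]
    module

end IsOrbit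

/-- The two sides agree on vectors which have the same color at all sites. -/
lemma IsColoredPerm.braid_mul_of_same (H : IsColoredPerm C P) {i j k : ι} (hij : i ≠ j)
    (hjk : j ≠ k) {x : ℂ} (hx : x * x = 1) {v : A} (hi : C i * v = x • v) (hj : C j * v = x • v)
    (hk : C k * v = x • v) (W : WordData) :
    leftBraid C P i j k W * v =
        (bpow x W.a * bpow x W.b * bpow x W.c) • (W.u.1 * W.v.1 * W.w.1) • v ∧
      rightBraid C P i j k W * v =
        (bpow x W.a * bpow x W.b * bpow x W.c) • (W.u.1 * W.v.1 * W.w.1) • v := by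
  refine ⟨?_, ?_⟩ <;>
  · simp only [leftBraid, rightBraid, mul_assoc, mul_smul_comm, decor_mul hi, decor_mul hj,
      H.braidOp_mul_of_same hij hx hi hj, H.braidOp_mul_of_same hjk hx hj hk]
    module

namespace IsColoredPerm

variable (H : IsColoredPerm C P) {i j k : ι} (hij : i ≠ j) (hik : i ≠ k) (hjk : j ≠ k)
include H hij hik hjk

/-- Of the nine matrix entries, six reduce to the three hypotheses, each used twice; the others
agree identically or by `sg² = 1`. -/
lemma leftWord_eq_rightWord (W : WordData) (hW : W.Even)
    (h₁ : W.u.1 * W.w.1 = W.v.1 + sg W.a * W.u.2 * W.w.2)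
    (h₂ : W.v.2 * W.w.1 = sg W.a * W.v.1 * W.w.2 + W.u.2)
    (h₃ : W.v.2 * W.u.1 = sg W.a * W.w.2 + W.u.2 * W.v.1) :
    leftWord C P i j k W = rightWord C P i j k W := by
  rw [H.leftWord_eq hij hik hjk, H.rightWord_eq hij hik hjk]
  congr 1
  rw [← sub_eq_zero]
  have ha := sg_mul_self W.a
  refine H.eq_zero_of_sectors hij hik hjk (fun x v hx hi hj hk => ?_)
    (fun x e₁ e₂ e₃ O => ?_)
  · obtain ⟨hl, hr⟩ := H.braid_mul_of_same hij hjk hx hi hj hk W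
    rw [sub_mul, hl, hr, sub_self]
  · obtain ⟨hl₁, hl₂, hl₃⟩ := O.leftBraid_mul H hij hjk W
    obtain ⟨hr₁, hr₂, hr₃⟩ := O.rightBraid_mul H hij hjk W
    rw [sub_mul, sub_mul, sub_mul, hl₁, hl₂, hl₃, hr₁, hr₂, hr₃, hW.bpow_eq O.sq, hW.sg_eq]
    generalize sg W.a = α at *
    generalize sg W.b = β at *
    refine ⟨?_, ?_, ?_⟩ <;> match_scalars
    · linear_combination β * h₁ - β * W.v.1 * ha
    · linear_combination α * β * h₂
    · ring
    · linear_combination α * β * h₃ + β * W.w.2 * ha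
    · linear_combination β * ha
    · linear_combination -β * h₂ + β * W.u.2 * ha
    · ring
    · linear_combination -h₃
    · linear_combination -h₁

end IsColoredPerm

namespace WordData

/-- The matrix elements of the difference of both sides for an odd number of decorations. -/
def defect (W : WordData) : Fin 9 → ℂ :=
  ![W.u.1 * W.w.1 + W.v.1 - sg W.a * W.u.2 * W.w.2,
    sg W.a * W.v.2 * W.w.1 + W.v.1 * W.w.2 - sg W.a * W.u.2,
    0,
    -(sg W.a * W.u.1 * W.v.2) - W.w.2 + sg W.a * W.u.2 * W.v.1,
    -2,
    -W.u.2 - sg W.a * W.v.1 * W.w.2 - W.v.2 * W.w.1,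
    0,
    sg W.b * (sg W.a * W.w.2 + W.u.2 * W.v.1 - W.u.1 * W.v.2),
    sg W.b * (sg W.a * W.u.2 * W.w.2 + W.v.1 - W.u.1 * W.w.1)]

/-- The matrix elements of the sum of both sides for an odd number of decorations. -/
def total (W : WordData) : Fin 10 → ℂ :=
  ![W.u.1 * W.w.1 - W.v.1 + sg W.a * W.u.2 * W.w.2,
    sg W.a * W.v.2 * W.w.1 - W.v.1 * W.w.2 + sg W.a * W.u.2,
    2 * (sg W.a * W.u.2 * W.v.2 * W.w.1),
    -(sg W.a * W.u.1 * W.v.2) + W.w.2 - sg W.a * W.u.2 * W.v.1,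
    -2 * (sg W.a * W.u.2 * W.v.1 * W.w.2),
    -W.u.2 - sg W.a * W.v.1 * W.w.2 + W.v.2 * W.w.1,
    2 * (sg W.b * W.u.1 * W.v.2 * W.w.2),
    sg W.b * (sg W.a * W.w.2 + W.u.2 * W.v.1 + W.u.1 * W.v.2),
    sg W.b * (sg W.a * W.u.2 * W.w.2 + W.v.1 + W.u.1 * W.w.1),
    2 * (sg W.b * W.u.1 * W.v.1 * W.w.1)]

end WordData

/-- The signed difference of the two sides. -/
def braidDefect (C : ι → A) (P : ι → ι → A) (i j k : ι) (W : WordData) : A :=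
  sg W.b • (leftBraid C P i j k W - rightBraid C P i j k W)

/-- The signed sum of the two sides. -/
def braidTotal (C : ι → A) (P : ι → ι → A) (i j k : ι) (W : WordData) : A :=
  sg W.b • (leftBraid C P i j k W + rightBraid C P i j k W)

namespace IsOrbit

variable {i j k : ι} {x : ℂ} {e₁ e₂ e₃ : A} (O : IsOrbit C P i j k x e₁ e₂ e₃)
  (H : IsColoredPerm C P) (hij : i ≠ j) (hjk : j ≠ k) {W : WordData} (hW : W.Odd)
include O H hij hjk hW

lemma braidDefect_mul :
    braidDefect C P i j k W * e₁ =
      x • (W.defect 0 • e₁ + W.defect 1 • e₂ + W.defect 2 • e₃) ∧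
    braidDefect C P i j k W * e₂ =
      x • (W.defect 3 • e₁ + W.defect 4 • e₂ + W.defect 5 • e₃) ∧
    braidDefect C P i j k W * e₃ =
      x • (W.defect 6 • e₁ + W.defect 7 • e₂ + W.defect 8 • e₃) := by
  obtain ⟨hl₁, hl₂, hl₃⟩ := O.leftBraid_mul H hij hjk W
  obtain ⟨hr₁, hr₂, hr₃⟩ := O.rightBraid_mul H hij hjk W
  simp only [braidDefect, smul_mul_assoc, sub_mul, hl₁, hl₂, hl₃, hr₁, hr₂, hr₃,
    hW.bpow_eq O.sq, hW.sg_eq]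
  have ha := sg_mul_self W.a
  have hb := sg_mul_self W.b
  simp only [WordData.defect, Matrix.cons_val]
  generalize sg W.a = α at *
  generalize sg W.b = β at *
  refine ⟨?_, ?_, ?_⟩ <;> match_scalars <;> grind

lemma braidTotal_mul :
    braidTotal C P i j k W * e₁ =
      x • (W.total 0 • e₁ + W.total 1 • e₂ + W.total 2 • e₃) ∧
    braidTotal C P i j k W * e₂ =
      x • (W.total 3 • e₁ + W.total 4 • e₂ + W.total 5 • e₃) ∧
    braidTotal C P i j k W * e₃ =
      x • (W.total 6 • e₁ + W.total 7 • e₂ + W.total 8 • e₃) := by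
  obtain ⟨hl₁, hl₂, hl₃⟩ := O.leftBraid_mul H hij hjk W
  obtain ⟨hr₁, hr₂, hr₃⟩ := O.rightBraid_mul H hij hjk W
  simp only [braidTotal, smul_mul_assoc, add_mul, hl₁, hl₂, hl₃, hr₁, hr₂, hr₃,
    hW.bpow_eq O.sq, hW.sg_eq]
  have ha := sg_mul_self W.a
  have hb := sg_mul_self W.b
  simp only [WordData.total, Matrix.cons_val]
  generalize sg W.a = α at *
  generalize sg W.b = β at *
  refine ⟨?_, ?_, ?_⟩ <;> match_scalars <;> grind

end IsOrbit

namespace IsColoredPerm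

variable (H : IsColoredPerm C P) {i j k : ι} (hij : i ≠ j) (hik : i ≠ k) (hjk : j ≠ k)
include H hij hik hjk

/-- The same-color sector drops out of the difference, so the nine entries on an orbit determine it.
-/
lemma braidDefect_eq {W W' : WordData} (hW : W.Odd) (hW' : W'.Odd)
    (h : W.defect = W'.defect) : braidDefect C P i j k W = braidDefect C P i j k W' := by
  rw [← sub_eq_zero]
  refine H.eq_zero_of_sectors hij hik hjk (fun x v hx hi hj hk => ?_)
    (fun x e₁ e₂ e₃ O => ?_)
  · obtain ⟨hl, hr⟩ := H.braid_mul_of_same hij hjk hx hi hj hk W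
    obtain ⟨hl', hr'⟩ := H.braid_mul_of_same hij hjk hx hi hj hk W'
    simp only [braidDefect, sub_mul, smul_mul_assoc, hl, hr, hl', hr', sub_self, smul_zero]
  · obtain ⟨h₁, h₂, h₃⟩ := O.braidDefect_mul H hij hjk hW
    obtain ⟨h₁', h₂', h₃'⟩ := O.braidDefect_mul H hij hjk hW'
    simp only [sub_mul, h₁, h₂, h₃, h₁', h₂', h₃', h, sub_self, and_self]

/-- In the sum of the two sides the same-color sector survives; it is governed by the tenth entry of
`total`. -/
lemma sum_braidTotal_eq_zero {κ : Type*} [Fintype κ] (t : κ → ℂ) (W : κ → WordData)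
    (hW : ∀ n, (W n).Odd) (h : ∀ m, ∑ n, t n * (W n).total m = 0) :
    ∑ n, t n • braidTotal C P i j k (W n) = 0 := by
  have aux : ∀ (x : ℂ) (e₁ e₂ e₃ : A) (a b c : Fin 10),
      ∑ n, t n • (x • ((W n).total a • e₁ + (W n).total b • e₂ + (W n).total c • e₃)) = 0 := by
    intro x e₁ e₂ e₃ a b c
    have : ∀ n, t n • (x • ((W n).total a • e₁ + (W n).total b • e₂ + (W n).total c • e₃)) =
        (x * (t n * (W n).total a)) • e₁ + (x * (t n * (W n).total b)) • e₂ +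
          (x * (t n * (W n).total c)) • e₃ := fun n => by module
    simp only [this, Finset.sum_add_distrib, ← Finset.sum_smul, ← Finset.mul_sum, h, mul_zero,
      zero_smul, add_zero]
  refine H.eq_zero_of_sectors hij hik hjk (fun x v hx hi hj hk => ?_)
    (fun x e₁ e₂ e₃ O => ?_)
  · have : ∀ n, t n • braidTotal C P i j k (W n) * v = (x * (t n * (W n).total 9)) • v := by
      intro n
      obtain ⟨hl, hr⟩ := H.braid_mul_of_same hij hjk hx hi hj hk (W n)
      simp only [braidTotal, smul_mul_assoc, add_mul, hl, hr, (hW n).bpow_eq hx, WordData.total,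
        Matrix.cons_val]
      module
    simp only [Finset.sum_mul, this, ← Finset.sum_smul, ← Finset.mul_sum, h, mul_zero, zero_smul]
  · simp only [Finset.sum_mul, smul_mul_assoc, (O.braidTotal_mul H hij hjk (hW _)).1,
      (O.braidTotal_mul H hij hjk (hW _)).2.1, (O.braidTotal_mul H hij hjk (hW _)).2.2, aux,
      and_self]

end IsColoredPerm
end Words

/-! ### Matrix entries for sums and differences of angles. -/

section Trigonometry

/-- Cosine and sine of the difference (`a = false`) or sum (`a = true`) of two angles, which are
given by their cosine and sine. -/
def angle (x y : ℂ × ℂ) (a : Bool) : ℂ × ℂ :=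
  (x.1 * y.1 + sg a * x.2 * y.2, x.2 * y.1 - sg a * x.1 * y.2)

/-- The spectral data in the Yang-Baxter equation for given decorations. -/
def word (x y z : ℂ × ℂ) (a b c : Bool) : WordData where
  u := angle x y a
  v := angle x z b
  w := angle y z c
  a := a
  b := b
  c := c

variable {x y z : ℂ × ℂ} (hx : x.1 ^ 2 + x.2 ^ 2 = 1) (hy : y.1 ^ 2 + y.2 ^ 2 = 1)
  (hz : z.1 ^ 2 + z.2 ^ 2 = 1)
include hx hy hz

/-- With `α = sg a`, evenness makes the angles of the three factors satisfy `v = u + α w`; these are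
the addition formulas for `cos (u + α w)`, `sin (v - α w)` and `sin (v - u)`. -/
lemma word_even_rel {a b c : Bool} (h : (word x y z a b c).Even) :
    (angle x y a).1 * (angle y z c).1 =
        (angle x z b).1 + sg a * (angle x y a).2 * (angle y z c).2 ∧
      (angle x z b).2 * (angle y z c).1 =
        sg a * (angle x z b).1 * (angle y z c).2 + (angle x y a).2 ∧
      (angle x z b).2 * (angle x y a).1 =
        sg a * (angle y z c).2 + (angle x y a).2 * (angle x z b).1 := by
  obtain ⟨x₁, x₂⟩ := x
  obtain ⟨y₁, y₂⟩ := y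
  obtain ⟨z₁, z₂⟩ := z
  have ha := sg_mul_self a
  have hb := sg_mul_self b
  have hc : sg c = sg a * sg b := h.sg_eq
  simp only [angle, hc] at *
  generalize sg a = α at *
  generalize sg b = β at *
  refine ⟨?_, ?_, ?_⟩ <;> grind

/-- The point is that the decorations do not occur on the right: all odd words have the same defect.
-/
lemma word_defect {a b c : Bool} (h : (word x y z a b c).Odd) :
    (word x y z a b c).defect = ![2 * x.1 * z.1, 2 * x.1 * y.2, 0, -2 * y.2 * z.1, -2,
      -2 * x.2 * y.1, 0, 2 * y.1 * z.2, 2 * x.2 * z.2] := by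
  obtain ⟨x₁, x₂⟩ := x
  obtain ⟨y₁, y₂⟩ := y
  obtain ⟨z₁, z₂⟩ := z
  have ha := sg_mul_self a
  have hb := sg_mul_self b
  have hc : sg c = -(sg a * sg b) := h.sg_eq
  simp only [WordData.defect, word, angle, hc] at *
  generalize sg a = α at *
  generalize sg b = β at *
  funext m
  fin_cases m <;> simp only [Fin.reduceFinMk, Matrix.cons_val, Matrix.cons_val_zero,
    Matrix.cons_val_one] <;> grind

/-- The sine of a signed sum of the three angles, with a sign. -/
def tripleSin (x y z : ℂ × ℂ) (a b : Bool) : ℂ :=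
  sg a * (x.2 * y.1 * z.1 - sg a * x.1 * y.2 * z.1 - sg b * x.1 * y.1 * z.2
    - sg a * sg b * x.2 * y.2 * z.2)

/-- The cosine of a signed sum of the three angles, with a sign. -/
def tripleCos (x y z : ℂ × ℂ) (a b : Bool) : ℂ :=
  sg b * (x.1 * y.1 * z.1 + sg b * x.2 * y.1 * z.2 + sg a * x.2 * y.2 * z.1
    - sg a * sg b * x.1 * y.2 * z.2)

/-- The decorations enter only through `tripleSin` and `tripleCos`, so ten linear conditions on the
coefficients reduce to two. -/
lemma word_total {a b c : Bool} (h : (word x y z a b c).Odd) (m : Fin 10) :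
    (word x y z a b c).total m =
      ![2 * y.2, 2 * z.1, 2 * x.2 * y.1 * z.1, -2 * x.1, -2 * x.1 * y.2 * z.1, 0,
        2 * x.1 * y.1 * z.2, 0, 0, 2 * x.2 * y.2 * z.2] m * tripleSin x y z a b +
      ![0, 0, 2 * x.1 * y.2 * z.2, 0, -2 * x.2 * y.1 * z.2, -2 * z.2, 2 * x.2 * y.2 * z.1,
        2 * x.2, 2 * y.1, 2 * x.1 * y.1 * z.1] m * tripleCos x y z a b := by
  obtain ⟨x₁, x₂⟩ := x
  obtain ⟨y₁, y₂⟩ := y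
  obtain ⟨z₁, z₂⟩ := z
  have ha := sg_mul_self a
  have hb := sg_mul_self b
  have hc : sg c = -(sg a * sg b) := h.sg_eq
  simp only [WordData.total, word, angle, tripleSin, tripleCos, hc] at *
  generalize sg a = α at *
  generalize sg b = β at *
  fin_cases m <;> simp only [Fin.reduceFinMk, Matrix.cons_val, Matrix.cons_val_zero,
    Matrix.cons_val_one] <;> grind

end Trigonometry

/-! ### Cancellation of the weighted sums over odd words. -/

section Coupling

/-- The decorations of the words with an odd number of decorations. -/
def oddDecor : Fin 4 → Bool × Bool × Bool :=
  ![(false, false, true), (false, true, false), (true, false, false), (true, true, true)]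

/-- The coefficients of the words in `oddDecor` in the product of three coupled R-matrices. -/
def oddCoeff (k l m : ℂ) : Fin 4 → ℂ := ![m, l, k, k * l * m]

/-- The word with the decorations `oddDecor n`. -/
def oddWord (x y z : ℂ × ℂ) (n : Fin 4) : WordData :=
  word x y z (oddDecor n).1 (oddDecor n).2.1 (oddDecor n).2.2

lemma odd_oddWord (x y z : ℂ × ℂ) (n : Fin 4) : (oddWord x y z n).Odd := by
  fin_cases n <;> rfl

/-- The relation between the coupling constants `k / sin`, `l / sin`, `m / sin` of the three
coupled R-matrices in the Yang-Baxter equation. -/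
structure IsCoupling (x y z : ℂ × ℂ) (k l m : ℂ) : Prop where
  exists_eq : ∃ f g h : ℂ, k = (angle x y false).2 * f ∧ l = (angle x z false).2 * g ∧
    m = (angle y z false).2 * h ∧
    (angle x z false).1 * f - (angle x y false).1 * g +
      (angle y z false).2 * (angle y z true).1 * (angle y z true).2 * (f * g * h) = 0 ∧
    (angle y z false).1 * f - (angle x y false).1 * h +
      (angle x z false).2 * (angle x z true).1 * (angle x z true).2 * (f * g * h) = 0 ∧
    (angle y z false).1 * g - (angle x z false).1 * h +
      (angle x y false).2 * (angle x y true).1 * (angle x y true).2 * (f * g * h) = 0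

variable {x y z : ℂ × ℂ} (hx : x.1 ^ 2 + x.2 ^ 2 = 1) (hy : y.1 ^ 2 + y.2 ^ 2 = 1)
  (hz : z.1 ^ 2 + z.2 ^ 2 = 1) {k l m : ℂ}
include hx hy hz

lemma sum_tripleSin (hk : IsCoupling x y z k l m) :
    ∑ n, oddCoeff k l m n * tripleSin x y z (oddDecor n).1 (oddDecor n).2.1 = 0 := by
  obtain ⟨f, g, h, rfl, rfl, rfl, h₁, h₂, h₃⟩ := hk
  obtain ⟨x₁, x₂⟩ := x
  obtain ⟨y₁, y₂⟩ := y
  obtain ⟨z₁, z₂⟩ := z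
  simp only [Fin.sum_univ_four, oddCoeff, oddDecor, tripleSin, angle, sg, Matrix.cons_val,
    Bool.false_eq_true, if_true, if_false] at *
  -- The three coupling relations are combined with weights `cos x`, `-cos y`, `cos z`; the four
  -- identities match the coefficients of `f`, `g`, `h` and `f * g * h`.
  have hf : (x₂ * y₁ - x₁ * y₂) * -(x₂ * y₁ * z₁ + x₁ * y₂ * z₁ - x₁ * y₁ * z₂ + x₂ * y₂ * z₂) =
      x₁ * (x₁ * z₁ + x₂ * z₂) - y₁ * (y₁ * z₁ + y₂ * z₂) := by grind
  have hg : (x₂ * z₁ - x₁ * z₂) * (x₂ * y₁ * z₁ - x₁ * y₂ * z₁ + x₁ * y₁ * z₂ + x₂ * y₂ * z₂) =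
      z₁ * (y₁ * z₁ + y₂ * z₂) - x₁ * (x₁ * y₁ + x₂ * y₂) := by grind
  have hh : (y₂ * z₁ - y₁ * z₂) * (x₂ * y₁ * z₁ - x₁ * y₂ * z₁ - x₁ * y₁ * z₂ - x₂ * y₂ * z₂) =
      y₁ * (x₁ * y₁ + x₂ * y₂) - z₁ * (x₁ * z₁ + x₂ * z₂) := by grind
  have hG : (x₂ * y₁ - x₁ * y₂) * (x₂ * z₁ - x₁ * z₂) * (y₂ * z₁ - y₁ * z₂) *
      -(x₂ * y₁ * z₁ + x₁ * y₂ * z₁ + x₁ * y₁ * z₂ - x₂ * y₂ * z₂) =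
      x₁ * ((y₂ * z₁ - y₁ * z₂) * (y₁ * z₁ - y₂ * z₂) * (y₂ * z₁ + y₁ * z₂)) -
        y₁ * ((x₂ * z₁ - x₁ * z₂) * (x₁ * z₁ - x₂ * z₂) * (x₂ * z₁ + x₁ * z₂)) +
        z₁ * ((x₂ * y₁ - x₁ * y₂) * (x₁ * y₁ - x₂ * y₂) * (x₂ * y₁ + x₁ * y₂)) := by
    grind
  linear_combination x₁ * h₁ - y₁ * h₂ + z₁ * h₃ + f * hf + g * hg + h * hh + f * g * h * hG

lemma sum_tripleCos (hk : IsCoupling x y z k l m) :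
    ∑ n, oddCoeff k l m n * tripleCos x y z (oddDecor n).1 (oddDecor n).2.1 = 0 := by
  obtain ⟨f, g, h, rfl, rfl, rfl, h₁, h₂, h₃⟩ := hk
  obtain ⟨x₁, x₂⟩ := x
  obtain ⟨y₁, y₂⟩ := y
  obtain ⟨z₁, z₂⟩ := z
  simp only [Fin.sum_univ_four, oddCoeff, oddDecor, tripleCos, angle, sg, Matrix.cons_val,
    Bool.false_eq_true, if_true, if_false] at *
  -- The same combination, now with weights `sin x`, `-sin y`, `sin z`.
  have hf : (x₂ * y₁ - x₁ * y₂) * (x₁ * y₁ * z₁ + x₂ * y₁ * z₂ - x₂ * y₂ * z₁ + x₁ * y₂ * z₂) =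
      x₂ * (x₁ * z₁ + x₂ * z₂) - y₂ * (y₁ * z₁ + y₂ * z₂) := by grind
  have hg : (x₂ * z₁ - x₁ * z₂) * -(x₁ * y₁ * z₁ - x₂ * y₁ * z₂ + x₂ * y₂ * z₁ + x₁ * y₂ * z₂) =
      z₂ * (y₁ * z₁ + y₂ * z₂) - x₂ * (x₁ * y₁ + x₂ * y₂) := by grind
  have hh : (y₂ * z₁ - y₁ * z₂) * (x₁ * y₁ * z₁ + x₂ * y₁ * z₂ + x₂ * y₂ * z₁ - x₁ * y₂ * z₂) =
      y₂ * (x₁ * y₁ + x₂ * y₂) - z₂ * (x₁ * z₁ + x₂ * z₂) := by grind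
  have hG : (x₂ * y₁ - x₁ * y₂) * (x₂ * z₁ - x₁ * z₂) * (y₂ * z₁ - y₁ * z₂) *
      -(x₁ * y₁ * z₁ - x₂ * y₁ * z₂ - x₂ * y₂ * z₁ - x₁ * y₂ * z₂) =
      x₂ * ((y₂ * z₁ - y₁ * z₂) * (y₁ * z₁ - y₂ * z₂) * (y₂ * z₁ + y₁ * z₂)) -
        y₂ * ((x₂ * z₁ - x₁ * z₂) * (x₁ * z₁ - x₂ * z₂) * (x₂ * z₁ + x₁ * z₂)) +
        z₂ * ((x₂ * y₁ - x₁ * y₂) * (x₁ * y₁ - x₂ * y₂) * (x₂ * y₁ + x₁ * y₂)) := by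
    grind
  linear_combination x₂ * h₁ - y₂ * h₂ + z₂ * h₃ + f * hf + g * hg + h * hh + f * g * h * hG

lemma sum_total (hk : IsCoupling x y z k l m) (j : Fin 10) :
    ∑ n, oddCoeff k l m n * (oddWord x y z n).total j = 0 := by
  have h : ∀ n, _ := fun n => word_total hx hy hz (odd_oddWord x y z n) j
  simp only [oddWord] at h ⊢
  simp only [h, mul_add, Finset.sum_add_distrib, mul_left_comm (oddCoeff k l m _),
    ← Finset.mul_sum, sum_tripleSin hx hy hz hk, sum_tripleCos hx hy hz hk, mul_zero, add_zero]

end Coupling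

/-! ### Assembling the two layers into the Yang-Baxter equation. -/

section YangBaxter

variable {ι A : Type*} [DecidableEq ι] [Ring A] [Algebra ℂ A] {C : ι → A} {P : ι → ι → A}

/-- The coupling of two R-matrices on different layers. -/
def coupledOp (C : ι → A) (P : ι → ι → A) (κ : ℂ) (u v : ℂ × ℂ) (a b c d : ι) : A :=
  xxOp C P u.1 u.2 a c * xxOp C P u.1 u.2 b d +
    κ • (xxOp C P v.1 v.2 a c * C a * xxOp C P v.1 v.2 b d * C b)

lemma coupledOp_eq (κ : ℂ) (u v : ℂ × ℂ) (a b c d : ι) : coupledOp C P κ u v a b c d =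
    decOp C P u false a c * decOp C P u false b d +
      κ • (decOp C P v true a c * decOp C P v true b d) := by
  simp [coupledOp, decOp, decor, mul_assoc]

lemma commute_decOp {X : A} {i j : ι} (hi : Commute X (C i)) (hj : Commute X (C j))
    (hP : Commute X (P i j)) (u : ℂ × ℂ) (a : Bool) : Commute X (decOp C P u a i j) := by
  have hd : Commute X (diffProj C i j) :=
    ((Commute.one_right X).sub_right (hi.mul_right hj)).smul_right _
  refine Commute.mul_right (((hd.mul_right hP).add_right (hd.smul_right _)).add_right
    ((((Commute.one_right X).sub_right hd).mul_right hP).smul_right _)) ?_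
  cases a
  · exact Commute.one_right X
  · exact hi

/-- Separates the two layers of a triple product. -/
lemma mul_mul_mul_of_commute {X X' X'' Y Y' Y'' : A} (h₁ : Commute Y X') (h₂ : Commute Y X'')
    (h₃ : Commute Y' X'') :
    X * Y * (X' * Y') * (X'' * Y'') = (X * X' * X'') * (Y * Y' * Y'') := by
  calc X * Y * (X' * Y') * (X'' * Y'') = X * (Y * X') * (Y' * X'') * Y'' := by
        simp only [mul_assoc]
    _ = X * X' * (Y * X'') * Y' * Y'' := by rw [h₁.eq, h₃.eq]; simp only [mul_assoc]
    _ = _ := by rw [h₂.eq]; simp only [mul_assoc]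

namespace IsColoredPerm

variable (H : IsColoredPerm C P)
include H

lemma commute_P_C {k l i : ι} (hkl : k ≠ l) (hik : i ≠ k) (hil : i ≠ l) :
    Commute (P k l) (C i) := by
  rw [commute_iff_eq, H.P_C k l i hkl, Equiv.swap_apply_of_ne_of_ne hik hil]

lemma commute_P_P {k l i j : ι} (hkl : k ≠ l) (hij : i ≠ j) (hik : i ≠ k) (hil : i ≠ l)
    (hjk : j ≠ k) (hjl : j ≠ l) : Commute (P k l) (P i j) := by
  rw [commute_iff_eq, H.P_P k l i j hkl hij, Equiv.swap_apply_of_ne_of_ne hik hil,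
    Equiv.swap_apply_of_ne_of_ne hjk hjl]

lemma commute_decOp_decOp {k l i j : ι} (hkl : k ≠ l) (hij : i ≠ j) (hik : i ≠ k) (hil : i ≠ l)
    (hjk : j ≠ k) (hjl : j ≠ l) (u v : ℂ × ℂ) (a b : Bool) :
    Commute (decOp C P u a k l) (decOp C P v b i j) := by
  refine commute_decOp ?_ ?_ ?_ v b
  · exact (commute_decOp (H.C_comm i k) (H.C_comm i l) (H.commute_P_C hkl hik hil).symm u a).symm
  · exact (commute_decOp (H.C_comm j k) (H.C_comm j l) (H.commute_P_C hkl hjk hjl).symm u a).symm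
  · exact (commute_decOp (H.commute_P_C hij hik.symm hjk.symm)
      (H.commute_P_C hij hil.symm hjl.symm)
      (H.commute_P_P hkl hij hik hil hjk hjl).symm u a).symm

variable {x y z : ℂ × ℂ} (hx : x.1 ^ 2 + x.2 ^ 2 = 1) (hy : y.1 ^ 2 + y.2 ^ 2 = 1)
  (hz : z.1 ^ 2 + z.2 ^ 2 = 1) {κ μ ν : ℂ}
include hx hy hz

lemma leftWord_eq_rightWord_of_even {i j k : ι} (hij : i ≠ j) (hik : i ≠ k) (hjk : j ≠ k)
    {a b c : Bool} (h : (word x y z a b c).Even) :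
    leftWord C P i j k (word x y z a b c) = rightWord C P i j k (word x y z a b c) := by
  obtain ⟨h₁, h₂, h₃⟩ := word_even_rel hx hy hz h
  exact H.leftWord_eq_rightWord hij hik hjk _ h h₁ h₂ h₃

/-- The words with an odd number of decorations in terms of their difference `Y` and sums `X`. -/
lemma exists_odd_eq {i j k : ι} (hij : i ≠ j) (hik : i ≠ k) (hjk : j ≠ k)
    (hκ : IsCoupling x y z κ μ ν) : ∃ (X : Fin 4 → A) (Y : A),
      ∑ n, oddCoeff κ μ ν n • X n = 0 ∧
      ∀ n, leftWord C P i j k (oddWord x y z n) =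
          (sg (oddDecor n).2.1 / 2) • (X n + Y) ∧
        rightWord C P i j k (oddWord x y z n) =
          (sg (oddDecor n).2.1 / 2) • (X n - Y) := by
  refine ⟨fun n => P i k * braidTotal C P i j k (oddWord x y z n),
    P i k * braidDefect C P i j k (oddWord x y z 0), ?_, fun n => ?_⟩
  · simp only [← mul_smul_comm, ← Finset.mul_sum]
    rw [H.sum_braidTotal_eq_zero hij hik hjk _ _ (odd_oddWord x y z) (sum_total hx hy hz hκ),
      mul_zero]
  · rw [H.braidDefect_eq hij hik hjk (odd_oddWord x y z 0) (odd_oddWord x y z n)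
      (by rw [oddWord, oddWord, word_defect hx hy hz (odd_oddWord x y z 0),
        word_defect hx hy hz (odd_oddWord x y z n)]),
      H.leftWord_eq hij hik hjk, H.rightWord_eq hij hik hjk, ← mul_add, ← mul_sub,
      ← mul_smul_comm, ← mul_smul_comm, braidTotal, braidDefect]
    have hb := sg_mul_self (oddDecor n).2.1
    have e : (oddWord x y z n).b = (oddDecor n).2.1 := rfl
    rw [e]
    constructor <;> congr 1 <;> match_scalars <;> grind

/-- The Yang-Baxter equation for coupled R-matrices. -/
theorem coupled_yangBaxter {a b c d e f : ι} (hab : a ≠ b) (hac : a ≠ c) (had : a ≠ d)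
    (hae : a ≠ e) (haf : a ≠ f) (hbc : b ≠ c) (hbd : b ≠ d) (hbe : b ≠ e) (hbf : b ≠ f)
    (hcd : c ≠ d) (hce : c ≠ e) (hcf : c ≠ f) (hde : d ≠ e) (hdf : d ≠ f) (hef : e ≠ f)
    (hκ : IsCoupling x y z κ μ ν) :
    coupledOp C P κ (angle x y false) (angle x y true) a b c d *
        coupledOp C P μ (angle x z false) (angle x z true) a b e f *
        coupledOp C P ν (angle y z false) (angle y z true) c d e f =
      coupledOp C P ν (angle y z false) (angle y z true) c d e f *
        coupledOp C P μ (angle x z false) (angle x z true) a b e f *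
        coupledOp C P κ (angle x y false) (angle x y true) a b c d := by
  have hl : ∀ p q r, decOp C P (angle x y p) p a c * decOp C P (angle x y p) p b d *
      (decOp C P (angle x z q) q a e * decOp C P (angle x z q) q b f) *
      (decOp C P (angle y z r) r c e * decOp C P (angle y z r) r d f) =
      leftWord C P a c e (word x y z p q r) * leftWord C P b d f (word x y z p q r) :=
    fun p q r => mul_mul_mul_of_commute
      (H.commute_decOp_decOp hbd hae hab had hbe.symm hde.symm _ _ _ _)
      (H.commute_decOp_decOp hbd hce hbc.symm hcd hbe.symm hde.symm _ _ _ _)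
      (H.commute_decOp_decOp hbf hce hbc.symm hcf hbe.symm hef _ _ _ _)
  have hr : ∀ p q r, decOp C P (angle y z r) r c e * decOp C P (angle y z r) r d f *
      (decOp C P (angle x z q) q a e * decOp C P (angle x z q) q b f) *
      (decOp C P (angle x y p) p a c * decOp C P (angle x y p) p b d) =
      rightWord C P a c e (word x y z p q r) * rightWord C P b d f (word x y z p q r) :=
    fun p q r => mul_mul_mul_of_commute
      (H.commute_decOp_decOp hdf hae had haf hde.symm hef _ _ _ _)
      (H.commute_decOp_decOp hdf hac had haf hcd hcf _ _ _ _)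
      (H.commute_decOp_decOp hbf hac hab haf hbc.symm hcf _ _ _ _)
  have he : ∀ p q r, (word x y z p q r).Even →
      leftWord C P a c e (word x y z p q r) * leftWord C P b d f (word x y z p q r) =
      rightWord C P a c e (word x y z p q r) * rightWord C P b d f (word x y z p q r) :=
    fun p q r h => by
      rw [H.leftWord_eq_rightWord_of_even hx hy hz hac hae hce h,
        H.leftWord_eq_rightWord_of_even hx hy hz hbd hbf hdf h]
  have ho : ∑ n, oddCoeff κ μ ν n • (leftWord C P a c e (oddWord x y z n) *
        leftWord C P b d f (oddWord x y z n)) =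
      ∑ n, oddCoeff κ μ ν n • (rightWord C P a c e (oddWord x y z n) *
        rightWord C P b d f (oddWord x y z n)) := by
    obtain ⟨X, Y, hX, h⟩ := H.exists_odd_eq hx hy hz hac hae hce hκ
    obtain ⟨X', Y', hX', h'⟩ := H.exists_odd_eq hx hy hz hbd hbf hdf hκ
    rw [← sub_eq_zero, ← Finset.sum_sub_distrib]
    -- The sign of a word occurs once in each layer and squares to one, leaving `(X Y' + Y X')/2`;
    -- `Y` and `Y'` do not depend on `n` and factor out of the sum.
    calc _ = ∑ n, ((1 / 2 : ℂ) • (oddCoeff κ μ ν n • X n * Y') +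
          (1 / 2 : ℂ) • (Y * oddCoeff κ μ ν n • X' n)) := by
          refine Finset.sum_congr rfl fun n _ => ?_
          rw [(h n).1, (h n).2, (h' n).1, (h' n).2]
          have hb := sg_mul_self (oddDecor n).2.1
          simp only [smul_mul_assoc, mul_smul_comm, add_mul, mul_add, sub_mul, mul_sub]
          match_scalars <;> grind
      _ = 0 := by
          rw [Finset.sum_add_distrib, ← Finset.smul_sum, ← Finset.smul_sum, ← Finset.sum_mul,
            ← Finset.mul_sum, hX, hX', zero_mul, mul_zero, smul_zero, add_zero]
  simp only [Fin.sum_univ_four, oddCoeff, oddWord, oddDecor, Matrix.cons_val] at ho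
  simp only [coupledOp_eq, add_mul, mul_add, smul_mul_assoc, mul_smul_comm, hl, hr]
  rw [he false false false rfl, he true true false rfl, he true false true rfl,
    he false true true rfl]
  rw [← sub_eq_zero] at ho ⊢
  rw [← ho]
  module

end IsColoredPerm

end YangBaxter

/-! ### Two-site relations and unitarity. -/

section Unitarity

variable {ι A : Type*} [DecidableEq ι] [Ring A] [Algebra ℂ A] {C : ι → A} {P : ι → ι → A}

namespace IsColoredPerm

variable (H : IsColoredPerm C P) {i j : ι} (hij : i ≠ j)
include H hij

lemma xxOp_mul_of_same {v : A} {x : ℂ} (hx : x * x = 1) (hi : C i * v = x • v)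
    (hj : C j * v = x • v) (c s : ℂ) : xxOp C P c s i j * v = c • (P i j * v) := by
  rw [H.xxOp_eq hij, mul_assoc, H.braidOp_mul_of_same hij hx hi hj, mul_smul_comm]

lemma xxOp_mul_of_diff {v : A} {x y : ℂ} (hx : x * y = -1) (hi : C i * v = x • v)
    (hj : C j * v = y • v) (c s : ℂ) : xxOp C P c s i j * v = P i j * v + s • v := by
  rw [H.xxOp_eq hij, mul_assoc, H.braidOp_mul_of_diff hij hx hi hj, mul_add, mul_smul_comm,
    ← mul_assoc, H.P_sq i j hij, one_mul]

lemma eq_of_two_colors {Z Z' : A}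
    (hS : ∀ (x : ℂ) (v w : A), x * x = 1 → P i j * v = w → P i j * w = v → C i * v = x • v →
      C j * v = x • v → C i * w = x • w → C j * w = x • w → Z * v = Z' * v)
    (hD : ∀ (x : ℂ) (v w : A), x * x = 1 → P i j * v = w → P i j * w = v → C i * v = x • v →
      C j * v = (-x) • v → C i * w = (-x) • w → C j * w = x • w → Z * v = Z' * v) : Z = Z' := by
  rw [← sub_eq_zero, ← mul_one (Z - Z')]
  refine H.mul_eq_zero_of_color i fun x hx => ?_
  refine H.mul_eq_zero_of_color j fun y hy => ?_
  have hi : C i * _ = x • _ := H.C_mul_add_other j i (x := y) (H.C_mul_add_self i 1 hx)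
  have hj : C j * _ = y • _ := H.C_mul_add_self j (1 + x • (C i * 1)) hy
  generalize 1 + x • (C i * 1) + y • (C j * (1 + x • (C i * 1))) = v at *
  have hP : P i j * (P i j * v) = v := by rw [← mul_assoc, H.P_sq i j hij, one_mul]
  have hi' : C i * (P i j * v) = y • (P i j * v) := H.C_mul_P_mul hij (by simpa using hj)
  have hj' : C j * (P i j * v) = x • (P i j * v) := H.C_mul_P_mul hij (by simpa using hi)
  rw [sub_mul, sub_eq_zero]
  rcases (mul_self_eq_mul_self_iff.1 (hy.trans hx.symm)) with rfl | rfl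
  · exact hS _ v _ hx rfl hP hi hj hi' hj'
  · exact hD _ v _ hx rfl hP hi hj hi' hj'

lemma xxOp_mul_xxOp_neg {c s : ℂ} (h : c ^ 2 + s ^ 2 = 1) :
    xxOp C P c s i j * xxOp C P c (-s) j i = (c ^ 2) • (1 : A) := by
  rw [H.xxOp_symm hij.symm]
  refine H.eq_of_two_colors hij (fun x v w hx hvw hwv hi hj hi' hj' => ?_)
    (fun x v w hx hvw hwv hi hj hi' hj' => ?_)
  · rw [mul_assoc, H.xxOp_mul_of_same hij hx hi hj, mul_smul_comm, hvw,
      H.xxOp_mul_of_same hij hx hi' hj', hwv, smul_mul_assoc, one_mul, smul_smul, pow_two]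
  · rw [mul_assoc, H.xxOp_mul_of_diff hij (by rw [mul_neg, hx]) hi hj, mul_add, mul_smul_comm, hvw,
      H.xxOp_mul_of_diff hij (by rw [neg_mul, hx]) hi' hj',
      H.xxOp_mul_of_diff hij (by rw [mul_neg, hx]) hi hj, hwv, hvw, smul_mul_assoc, one_mul]
    match_scalars <;> grind

lemma xxOp_C_mul_xxOp_C {c s : ℂ} (h : c ^ 2 + s ^ 2 = 1) :
    xxOp C P c s i j * C i * (xxOp C P c s j i * C j) = (c ^ 2) • (1 : A) := by
  rw [H.xxOp_symm hij.symm]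
  refine H.eq_of_two_colors hij (fun x v w hx hvw hwv hi hj hi' hj' => ?_)
    (fun x v w hx hvw hwv hi hj hi' hj' => ?_)
  · simp only [mul_assoc, mul_smul_comm, smul_mul_assoc, one_mul, hi, hj, hi', hj', hvw, hwv,
      H.xxOp_mul_of_same hij hx hi hj, H.xxOp_mul_of_same hij hx hi' hj']
    match_scalars
    linear_combination c ^ 2 * hx
  · simp only [mul_assoc, mul_add, mul_smul_comm, smul_mul_assoc, one_mul, hi, hj, hi', hj', hvw,
      hwv, H.xxOp_mul_of_diff hij (show x * -x = -1 by rw [mul_neg, hx]) hi hj,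
      H.xxOp_mul_of_diff hij (show -x * x = -1 by rw [neg_mul, hx]) hi' hj', smul_add]
    match_scalars <;> grind

/-- This makes the mixed terms of the unitarity product cancel. No relation between the two
parameter pairs is needed. -/
lemma xxOp_mul_xxOp_C (c s c' s' : ℂ) :
    xxOp C P c s i j * (xxOp C P c' s' j i * C j) =
      xxOp C P c' s' i j * C i * xxOp C P c (-s) j i := by
  rw [H.xxOp_symm hij.symm, H.xxOp_symm hij.symm]
  refine H.eq_of_two_colors hij (fun x v w hx hvw hwv hi hj hi' hj' => ?_)
    (fun x v w hx hvw hwv hi hj hi' hj' => ?_)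
  · simp only [mul_assoc, mul_smul_comm, hi, hj, hi', hj', hvw, hwv,
      H.xxOp_mul_of_same hij hx hi hj, H.xxOp_mul_of_same hij hx hi' hj']
    module
  · simp only [mul_assoc, mul_add, mul_smul_comm, hi, hj, hi', hj', hvw,
      hwv, H.xxOp_mul_of_diff hij (show x * -x = -1 by rw [mul_neg, hx]) hi hj,
      H.xxOp_mul_of_diff hij (show -x * x = -1 by rw [neg_mul, hx]) hi' hj', smul_add]
    module

omit hij in
/-- The unitarity relation for coupled R-matrices. -/
theorem coupled_unitarity {a b c d : ι} (hab : a ≠ b) (hac : a ≠ c) (had : a ≠ d) (hbc : b ≠ c)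
    (hbd : b ≠ d) (hcd : c ≠ d) (κ : ℂ) {u v : ℂ × ℂ} (hu : u.1 ^ 2 + u.2 ^ 2 = 1)
    (hv : v.1 ^ 2 + v.2 ^ 2 = 1) :
    coupledOp C P κ u v a b c d * coupledOp C P (-κ) (u.1, -u.2) v c d a b =
      (u.1 ^ 4 - κ ^ 2 * v.1 ^ 4) • (1 : A) := by
  have hl : ∀ p q (w w' : ℂ × ℂ), decOp C P w p a c * decOp C P w p b d *
      (decOp C P w' q c a * decOp C P w' q d b) =
      (decOp C P w p a c * decOp C P w' q c a) * (decOp C P w p b d * decOp C P w' q d b) :=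
    fun p q w w' =>
      (H.commute_decOp_decOp hbd hac.symm hbc.symm hcd hab had w w' p q).mul_mul_mul_comm _ _
  have h₁ : ∀ {i j}, i ≠ j → decOp C P u false i j * decOp C P (u.1, -u.2) false j i =
      (u.1 ^ 2) • (1 : A) := fun h => by simpa [decOp, decor] using H.xxOp_mul_xxOp_neg h hu
  have h₂ : ∀ {i j}, i ≠ j → decOp C P v true i j * decOp C P v true j i =
      (v.1 ^ 2) • (1 : A) := fun h => by simpa [decOp, decor] using H.xxOp_C_mul_xxOp_C h hv
  -- Applied on both layers, this identifies the two mixed terms, whose coefficients are `-κ` and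
  -- `κ`.
  have h₃ : ∀ {i j}, i ≠ j → decOp C P u false i j * decOp C P v true j i =
      decOp C P v true i j * decOp C P (u.1, -u.2) false j i := fun h => by
    simpa [decOp, decor] using H.xxOp_mul_xxOp_C h u.1 u.2 v.1 v.2
  simp only [coupledOp_eq, add_mul, mul_add, smul_mul_assoc, mul_smul_comm, hl, h₁ hac, h₁ hbd,
    h₂ hac, h₂ hbd, h₃ hac, h₃ hbd, one_mul]
  module

end IsColoredPerm

end Unitarity

/-! ### The graded tensor product as an instance of the abstract setting. -/

section Concrete

variable {N M n : ℕ}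

/-- The diagonal entries of `C`. -/
def color (N M : ℕ) (j : Fin (N + M)) : ℂ := matC N M j j

lemma color_mul_self (j : Fin (N + M)) : color N M j * color N M j = 1 := by
  simp only [color, matC, projCompl, proj, Matrix.sub_apply, Matrix.diagonal_apply_eq,
    Matrix.one_apply_eq]
  split_ifs <;> norm_num

lemma matC_eq : matC N M = Matrix.diagonal (color N M) := by
  ext i j
  rcases eq_or_ne i j with rfl | h
  · simp [color]
  · simp [matC, projCompl, proj, h]

lemma proj_eq : proj N M = Matrix.diagonal fun j => (1 + color N M j) / 2 := by
  rw [proj]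
  congr 1
  funext j
  simp only [color, matC, projCompl, proj, Matrix.sub_apply, Matrix.diagonal_apply_eq,
    Matrix.one_apply_eq]
  split_ifs <;> norm_num

lemma projCompl_eq : projCompl N M = Matrix.diagonal fun j => (1 - color N M j) / 2 := by
  rw [projCompl, proj_eq, ← Matrix.diagonal_one, Matrix.diagonal_sub]
  congr 1
  funext j
  ring

lemma site_matC (i : Fin n) :
    site N M i (matC N M) = Matrix.diagonal fun x => color N M (x i) := by
  rw [matC_eq, site_diagonal]

/-- Permutations move diagonal units between sites without signs. Of `π` only the fact that `C` is
diagonal with square one matters, so the convention for `N = M = 1` needs no separate treatment. -/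
lemma isColoredPerm_site (N M n : ℕ) :
    IsColoredPerm (fun i : Fin n => site N M i (matC N M)) (perm N M) where
  C_sq i := by simp only [site_matC, Matrix.diagonal_mul_diagonal, color_mul_self]; rfl
  C_comm i j := by simp only [site_matC, Matrix.diagonal_mul_diagonal, mul_comm]
  P_symm i j h := perm_symm h
  P_sq i j h := perm_mul_self h
  P_C k l i h := by
    simp only [matC_eq, site_diagonal_eq_sum, Finset.mul_sum, Finset.sum_mul, mul_smul_comm,
      smul_mul_assoc, perm_mul_unitAt h]
  P_P k l i j h _ := perm_mul_perm h

lemma sigma_eq (i j : Fin n) :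
    sigma N M i j = diffProj (fun i : Fin n => site N M i (matC N M)) i j := by
  simp only [sigma, diffProj, site_matC, proj_eq, projCompl_eq, site_diagonal,
    Matrix.diagonal_mul_diagonal, Matrix.diagonal_add, ← Matrix.diagonal_one, Matrix.diagonal_sub,
    ← Matrix.diagonal_smul]
  congr 1
  funext x
  simp only [Pi.smul_apply, smul_eq_mul]
  ring

lemma xxR_eq (i j : Fin n) (t : ℂ) : xxR N M i j t =
    xxOp (fun i : Fin n => site N M i (matC N M)) (perm N M) (Complex.cos t) (Complex.sin t)
      i j := by
  rw [xxR, xxOp, sigma_eq]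

/-- Cosine and sine of an angle. -/
def cosSin (t : ℂ) : ℂ × ℂ := (Complex.cos t, Complex.sin t)

lemma cosSin_sq (t : ℂ) : (cosSin t).1 ^ 2 + (cosSin t).2 ^ 2 = 1 := by
  simp [cosSin]

lemma angle_cosSin_false (s t : ℂ) : angle (cosSin s) (cosSin t) false = cosSin (s - t) := by
  simp [angle, cosSin, sg, Complex.cos_sub, Complex.sin_sub]

lemma angle_cosSin_true (s t : ℂ) : angle (cosSin s) (cosSin t) true = cosSin (s + t) := by
  simp [angle, cosSin, sg, Complex.cos_add, Complex.sin_add, sub_eq_add_neg]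

/-- The coefficient of the decorated part of `hubbardR`. -/
def hubbardCoeff (h : ℂ → ℂ) (s t : ℂ) : ℂ :=
  Complex.sin (s - t) / Complex.sin (s + t) * Complex.tanh (h s + h t)

lemma hubbardR_eq (h : ℂ → ℂ) (a b c d : Fin n) (s t : ℂ) :
    hubbardR N M h a b c d s t =
      coupledOp (fun i : Fin n => site N M i (matC N M)) (perm N M) (hubbardCoeff h s t)
        (cosSin (s - t)) (cosSin (s + t)) a b c d := by
  simp only [hubbardR, coupledOp, xxR_eq, cosSin, hubbardCoeff]

end Concrete

/-! ### Consequences of the constraint on `h`. -/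

section Hyperbolic

variable {U : ℂ} {h : ℂ → ℂ} (hh : ∀ t : ℂ, Complex.sinh (2 * h t) = U * Complex.sin (2 * t))
include hh

/-- Half the sum of the constraint at `s` and at `t`; half the difference gives `cosh_mul_sinh`. -/
lemma sinh_mul_cosh (s t : ℂ) : Complex.sinh (h s + h t) * Complex.cosh (h s - h t) =
    U * Complex.sin (s + t) * Complex.cos (s - t) := by
  have h₁ := hh s
  have h₂ := hh t
  rw [show 2 * h s = (h s + h t) + (h s - h t) by ring, Complex.sinh_add,
    show 2 * s = (s + t) + (s - t) by ring, Complex.sin_add] at h₁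
  rw [show 2 * h t = (h s + h t) - (h s - h t) by ring, Complex.sinh_sub,
    show 2 * t = (s + t) - (s - t) by ring, Complex.sin_sub] at h₂
  linear_combination (h₁ + h₂) / 2

lemma cosh_mul_sinh (s t : ℂ) : Complex.cosh (h s + h t) * Complex.sinh (h s - h t) =
    U * Complex.cos (s + t) * Complex.sin (s - t) := by
  have h₁ := hh s
  have h₂ := hh t
  rw [show 2 * h s = (h s + h t) + (h s - h t) by ring, Complex.sinh_add,
    show 2 * s = (s + t) + (s - t) by ring, Complex.sin_add] at h₁
  rw [show 2 * h t = (h s + h t) - (h s - h t) by ring, Complex.sinh_sub,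
    show 2 * t = (s + t) - (s - t) by ring, Complex.sin_sub] at h₂
  linear_combination (h₁ - h₂) / 2

/-- Eliminating `U` between the two product formulas relates `tanh (h s + h t)` to `h s - h t`. -/
lemma hubbardCoeff_mul {s t : ℂ} (hr : Regular h s t) :
    hubbardCoeff h s t * Complex.cos (s + t) * Complex.cosh (h s - h t) =
      Complex.cos (s - t) * Complex.sinh (h s - h t) := by
  have h₁ := sinh_mul_cosh hh s t
  have h₂ := cosh_mul_sinh hh s t
  obtain ⟨hs, hc⟩ := hr
  rw [hubbardCoeff, Complex.tanh_eq_sinh_div_cosh]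
  field_simp
  linear_combination Complex.sin (s - t) * Complex.cos (s + t) * h₁ -
    Complex.sin (s + t) * Complex.cos (s - t) * h₂

/-- The coupling constant `tanh (h s + h t) / sin (s + t)` in terms of `cosh (2 h)`. -/
lemma coupling_rel {s t : ℂ} (hr : Regular h s t) {g : ℂ}
    (hg : g = Complex.tanh (h s + h t) / Complex.sin (s + t)) :
    U * Complex.cos (s - t) = g * (Complex.cosh (2 * h s) + Complex.cosh (2 * h t)) / 2 ∧
      U * (Complex.sin (s - t) * Complex.cos (s + t) * Complex.sin (s + t)) * g =
        (Complex.cosh (2 * h s) - Complex.cosh (2 * h t)) / 2 ∧ (U = 0 → g = 0) := by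
  have h₁ := sinh_mul_cosh hh s t
  have h₂ := cosh_mul_sinh hh s t
  obtain ⟨hs, hc⟩ := hr
  have e : g * Complex.sin (s + t) * Complex.cosh (h s + h t) = Complex.sinh (h s + h t) := by
    rw [hg, Complex.tanh_eq_sinh_div_cosh]
    field_simp
  have ep : Complex.cosh (2 * h s) = Complex.cosh (h s + h t) * Complex.cosh (h s - h t) +
      Complex.sinh (h s + h t) * Complex.sinh (h s - h t) := by
    rw [← Complex.cosh_add]
    ring_nf
  have em : Complex.cosh (2 * h t) = Complex.cosh (h s + h t) * Complex.cosh (h s - h t) -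
      Complex.sinh (h s + h t) * Complex.sinh (h s - h t) := by
    rw [← Complex.cosh_sub]
    ring_nf
  rw [ep, em]
  refine ⟨?_, ?_, fun hU => ?_⟩
  · refine mul_left_cancel₀ hs ?_
    linear_combination -h₁ - Complex.cosh (h s - h t) * e
  · refine mul_left_cancel₀ hc ?_
    linear_combination -g * Complex.sin (s + t) * Complex.cosh (h s + h t) * h₂ +
      Complex.cosh (h s + h t) * Complex.sinh (h s - h t) * e
  -- For `U = 0` the second product formula gives `sinh (h s - h t) = 0`, hence `cosh (h s - h t) ≠
  -- 0`, and the first then kills `sinh (h s + h t)`.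
  · rw [hU, zero_mul, zero_mul] at h₁ h₂
    have hq : Complex.sinh (h s - h t) = 0 := (mul_eq_zero.1 h₂).resolve_left hc
    have hq' : Complex.cosh (h s - h t) ≠ 0 := fun h0 => by
      have := Complex.cosh_sq_sub_sinh_sq (h s - h t)
      simp [h0, hq] at this
    rw [hg, Complex.tanh_eq_sinh_div_cosh, (mul_eq_zero.1 h₁).resolve_right hq', zero_div, zero_div]

/-- After multiplication by `U`, every term becomes a product of two couplings times half a sum or
difference of values of `cosh (2 h)`, and these cancel. Since this divides by `U`, the case `U = 0`
is separate; there all couplings vanish. -/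
lemma isCoupling {t₁ t₂ t₃ : ℂ} (h₁₂ : Regular h t₁ t₂) (h₁₃ : Regular h t₁ t₃)
    (h₂₃ : Regular h t₂ t₃) : IsCoupling (cosSin t₁) (cosSin t₂) (cosSin t₃)
      (hubbardCoeff h t₁ t₂) (hubbardCoeff h t₁ t₃) (hubbardCoeff h t₂ t₃) := by
  obtain ⟨a₁, b₁, c₁⟩ := coupling_rel hh h₁₂ rfl
  obtain ⟨a₂, b₂, c₂⟩ := coupling_rel hh h₁₃ rfl
  obtain ⟨a₃, b₃, c₃⟩ := coupling_rel hh h₂₃ rfl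
  have hκ : ∀ s t, hubbardCoeff h s t = (angle (cosSin s) (cosSin t) false).2 *
      (Complex.tanh (h s + h t) / Complex.sin (s + t)) := fun s t => by
    rw [angle_cosSin_false, hubbardCoeff, cosSin, div_mul_eq_mul_div, mul_div_assoc]
  refine ⟨_, _, _, hκ _ _, hκ _ _, hκ _ _, ?_⟩
  generalize Complex.tanh (h t₁ + h t₂) / Complex.sin (t₁ + t₂) = f at *
  generalize Complex.tanh (h t₁ + h t₃) / Complex.sin (t₁ + t₃) = g at *
  generalize Complex.tanh (h t₂ + h t₃) / Complex.sin (t₂ + t₃) = k at *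
  simp only [angle_cosSin_false, angle_cosSin_true]
  simp only [cosSin]
  by_cases hU : U = 0
  · simp [c₁ hU, c₂ hU, c₃ hU]
  · refine ⟨?_, ?_, ?_⟩ <;> refine mul_left_cancel₀ hU ?_
    · linear_combination f * a₂ - g * a₁ + f * g * b₃
    · linear_combination f * a₃ - k * a₁ + f * k * b₂
    · linear_combination g * a₃ - k * a₂ + g * k * b₁

end Hyperbolic

end SuperHubbard

end

/-! ### The main theorem. -/

theorem mainTheorem2 (N M : ℕ) (U : ℂ) (h : ℂ → ℂ)
    (hh : ∀ t : ℂ, Complex.sinh (2 * h t) = U * Complex.sin (2 * t)) :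
    -- Yang-Baxter equation in the six-fold graded tensor product
    (∀ t₁ t₂ t₃ : ℂ,
      SuperHubbard.Regular h t₁ t₂ → SuperHubbard.Regular h t₁ t₃ →
      SuperHubbard.Regular h t₂ t₃ →
        SuperHubbard.hubbardR N M h (0 : Fin 6) 1 2 3 t₁ t₂ *
            SuperHubbard.hubbardR N M h (0 : Fin 6) 1 4 5 t₁ t₃ *
            SuperHubbard.hubbardR N M h (2 : Fin 6) 3 4 5 t₂ t₃ =
          SuperHubbard.hubbardR N M h (2 : Fin 6) 3 4 5 t₂ t₃ *
            SuperHubbard.hubbardR N M h (0 : Fin 6) 1 4 5 t₁ t₃ *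
            SuperHubbard.hubbardR N M h (0 : Fin 6) 1 2 3 t₁ t₂) ∧
    (∀ t₁ t₂ : ℂ, SuperHubbard.Regular h t₁ t₂ →
      -- unitarity relation in the four-fold graded tensor product
      SuperHubbard.hubbardR N M h (0 : Fin 4) 1 2 3 t₁ t₂ *
          SuperHubbard.hubbardR N M h (2 : Fin 4) 3 0 1 t₂ t₁ =
        (Complex.cos (t₁ - t₂) ^ 4 -
          (Complex.sin (t₁ - t₂) / Complex.sin (t₁ + t₂) * Complex.tanh (h t₁ + h t₂)) ^ 2 *
            Complex.cos (t₁ + t₂) ^ 4) • (1 : SuperHubbard.Op N M 4) ∧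
      -- rewriting of the unitarity coefficient
      (Complex.cosh (h t₁ - h t₂) ≠ 0 →
        Complex.cos (t₁ - t₂) ^ 4 -
            (Complex.sin (t₁ - t₂) / Complex.sin (t₁ + t₂) * Complex.tanh (h t₁ + h t₂)) ^ 2 *
              Complex.cos (t₁ + t₂) ^ 4 =
          Complex.cos (t₁ - t₂) ^ 2 *
            (Complex.cos (t₁ - t₂) ^ 2 -
              (Complex.tanh (h t₁ - h t₂) * Complex.cos (t₁ + t₂)) ^ 2)) ∧
      -- the same rewriting without the factors `cos (t₁ + t₂)`
      (Complex.cosh (h t₁ - h t₂) ≠ 0 → Complex.cos (t₁ + t₂) ≠ 0 →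
        Complex.cos (t₁ - t₂) ^ 4 -
            (Complex.sin (t₁ - t₂) / Complex.sin (t₁ + t₂) * Complex.tanh (h t₁ + h t₂)) ^ 2 =
          Complex.cos (t₁ - t₂) ^ 2 *
            (Complex.cos (t₁ - t₂) ^ 2 -
              (Complex.tanh (h t₁ - h t₂) / Complex.cos (t₁ + t₂)) ^ 2))) := by

  have H := fun n => SuperHubbard.isColoredPerm_site N M n
  refine ⟨fun t₁ t₂ t₃ h₁₂ h₁₃ h₂₃ => ?_, fun t₁ t₂ hr => ⟨?_, fun hc => ?_, fun hc hs => ?_⟩⟩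
  · simp only [SuperHubbard.hubbardR_eq, ← SuperHubbard.angle_cosSin_false,
      ← SuperHubbard.angle_cosSin_true]
    exact (H 6).coupled_yangBaxter (SuperHubbard.cosSin_sq t₁) (SuperHubbard.cosSin_sq t₂)
      (SuperHubbard.cosSin_sq t₃) (by decide) (by decide) (by decide) (by decide) (by decide)
      (by decide) (by decide) (by decide) (by decide) (by decide) (by decide) (by decide)
      (by decide) (by decide) (by decide) (SuperHubbard.isCoupling hh h₁₂ h₁₃ h₂₃)
  · have hu : SuperHubbard.cosSin (t₂ - t₁) =
        ((SuperHubbard.cosSin (t₁ - t₂)).1, -(SuperHubbard.cosSin (t₁ - t₂)).2) := by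
      simp only [SuperHubbard.cosSin, ← neg_sub t₁ t₂, Complex.cos_neg, Complex.sin_neg]
    have hκ : SuperHubbard.hubbardCoeff h t₂ t₁ = -SuperHubbard.hubbardCoeff h t₁ t₂ := by
      simp only [SuperHubbard.hubbardCoeff, ← neg_sub t₁ t₂, Complex.sin_neg, add_comm t₂,
        add_comm (h t₂)]
      ring
    rw [SuperHubbard.hubbardR_eq, SuperHubbard.hubbardR_eq, hu, hκ, add_comm t₂]
    exact (H 4).coupled_unitarity (by decide) (by decide) (by decide) (by decide) (by decide)
      (by decide) _ (SuperHubbard.cosSin_sq _) (SuperHubbard.cosSin_sq _)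
  all_goals
    have e := SuperHubbard.hubbardCoeff_mul hh hr
    rw [SuperHubbard.hubbardCoeff] at e
    generalize Complex.sin (t₁ - t₂) / Complex.sin (t₁ + t₂) * Complex.tanh (h t₁ + h t₂) = κ at *
    -- Substituting this once for each factor `κ cos (t₁ + t₂)` yields both rewritings; the second
    -- first divides by `cos (t₁ + t₂)`.
    have e' : κ * Complex.cos (t₁ + t₂) = Complex.cos (t₁ - t₂) * Complex.tanh (h t₁ - h t₂) := by
      rw [Complex.tanh_eq_sinh_div_cosh, ← mul_div_assoc, eq_div_iff hc, e]
  · linear_combination -Complex.cos (t₁ + t₂) ^ 2 * (κ * Complex.cos (t₁ + t₂) +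
      Complex.cos (t₁ - t₂) * Complex.tanh (h t₁ - h t₂)) * e'
  · rw [← eq_div_iff hs] at e'
    rw [e']
    ring
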